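/- **Setting.** Let $d\ge 1$, $\mathcal S=\mathcal S(\mathbb R^d)$ the real Schwartz functions and $\mathcal S'$ the real tempered distributions with the weak topology and its Borel $\sigma$-algebra. Let $\psi:\mathbb R\to\mathbb C$ be a Lévy characteristic (continuous, $\psi(0)=0$, $\psi(-t)=\overline{\psi(t)}$, and $\sum_{i,j}\xi_i\bar\xi_j\psi(t_i-t_j)\ge 0$ whenever $\sum_i\xi_i=0$) that is infinitely often differentiable at $0$, and put $$c_l=(-i)^l\,\frac{d^l\psi}{dt^l}(0),\qquad l\ge 1 .$$ Let $g:\mathbb R^d\to\mathbb R$ be integrable, with $g\in L^l(\mathbb R^d)$ for every $l\ge1$ with $c_l\neq0$. Let $\nu_0$ be the convoluted Lévy noise measure on $\mathcal S'$, i.e. the law of $\phi=g*\eta$ with $\eta$ the Lévy noise with $\mathbb E\,e^{i\eta(f)}=\exp\int\psi(f)\,dx$; explicitly, $\nu_0$ is a probability measure with $$\int_{\mathcal S'}e^{i\phi(h)}\,d\nu_0(\phi)=\exp\int_{\mathbb R^d}\psi\Big(\int_{\mathbb R^d}g(x-z)h(x)\,dx\Big)dz,\qquad h\in\mathcal S .$$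 Assume that $\nu_0$ is (ultra-violet regularized so that it is) supported on continuous functions; then $\phi(x)$ denotes the value of the continuous function $\phi$ at $x$. For a finite nonempty family of points the truncated moment functions $\langle J\rangle^T=\langle\prod_{j\in J}\phi(x_j)\rangle^T_{\nu_0}$ are defined recursively by $\langle\prod_{j\in J}\phi(x_j)\rangle_{\nu_0}=\sum_{I}\prod_{B\in I}\langle B\rangle^T$, the sum running over all partitions $I$ of $J$. A generalized Feynman graph with $n$ outer full vertices (one leg each) and $m$ inner full vertices (the $j$-th with $p_j$ distinguishable legs) has in addition some number $k$ of inner empty vertices; each edge joins one leg of a full vertex to an empty vertex, each leg lies on exactly one edge, and each empty vertex is met by at least one edge. For a polynomial $v(\phi)=\sum_p\lambda_p\phi^p$, $\mathcal F(n,m)$ is the set of those graphs with $1\le p_j\le\deg v$ and $\lambda_{p_j}\ne0$ for all $j$. For $\Lambda\subset\mathbb R^d$ bounded and measurable, the value $\mathcal V_\Lambda[G](x_1,\dots,x_n)$ is obtained by assigning $x_1,\dots,x_n$ to the outer and $y_1,\dots,y_m$ to the inner full vertices, multiplying, over all empty vertices, the truncated moment functions evaluated at the full vertex points where the edges of the empty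 vertex end, multiplying by $\lambda_p$ for each inner full vertex with $p$ legs, and integrating $y_1,\dots,y_m$ over $\Lambda$. **Theorem.** 1. The $c_l$ are real. If moreover $\psi(t)=iat-\frac{\sigma^2}{2}t^2+z\int(e^{ist}-1)\,dr(s)$ with $a,\sigma\in\mathbb R$, $z\ge0$ and a probability measure $r$ on $\mathbb R\setminus\{0\}$ with all moments, then $c_l=\delta_{l,1}a+\delta_{l,2}\sigma^2+z\int s^l\,dr(s)$ for $l\ge1$. 2. All moments $\langle\phi(x_1)\cdots\phi(x_l)\rangle_{\nu_0}$ exist, and for all $l\ge1$ and all $x_1,\dots,x_l\in\mathbb R^d$ (coinciding points allowed) $$\langle\phi(x_1)\cdots\phi(x_l)\rangle^T_{\nu_0}=c_l\int_{\mathbb R^d}g(x_1-z)\cdots g(x_l-z)\,dz ,$$ where $c_l\prod_j g(x_j-\cdot)$ is integrable. 3. For every polynomial $v$, every bounded measurable $\Lambda$, all $n,m\ge 0$, every $G\in\mathcal F(n,m)$ and all $x_1,\dots,x_n\in\mathbb R^d$, the value $\mathcal V_\Lambda[G](x_1,\dots,x_n)$ can be calculated as follows: assign $x_1,\dots,x_n$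 to the outer full vertices, $y_1,\dots,y_m$ to the inner full vertices and $z_1,\dots,z_k$ to the empty vertices; multiply by $g(w-z_q)$ for each edge from a full vertex with value $w$ to the $q$-th empty vertex, by $c_l$ for each empty vertex with $l$ legs, and by $\lambda_p$ for each inner full vertex with $p$ legs; integrate $y_1,\dots,y_m$ over $\Lambda$ and $z_1,\dots,z_k$ over $\mathbb R^d$. All integrals converge absolutely. -/

import Mathlib

open MeasureTheory
open scoped SchwartzMap ContDiff ENNReal

noncomputable section

namespace LevyFeynman

/-- The underlying space `ℝ^d`. -/
abbrev Space (d : ℕ) : Type := EuclideanSpace ℝ (Fin d)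

/-- Real tempered distributions on `ℝ^d`, with the weak topology (pointwise convergence on
Schwartz functions). -/
abbrev Tempered (d : ℕ) : Type := 𝓢(Space d, ℝ) →Lₚₜ[ℝ] ℝ

/-- The Borel sigma-algebra of the weak topology. -/
instance (d : ℕ) : MeasurableSpace (Tempered d) := borel _

instance (d : ℕ) : BorelSpace (Tempered d) := ⟨rfl⟩

/-! ### Lévy characteristics -/

/-- A Lévy characteristic: a continuous, normalized, hermitian and conditionally positive definite
function `ψ : ℝ → ℂ`. -/
structure IsLevyCharacteristic (ψ : ℝ → ℂ) : Prop where
  continuous : Continuous ψ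
  map_zero : ψ 0 = 0
  hermitian : ∀ t : ℝ, ψ (-t) = starRingEnd ℂ (ψ t)
  condPosDef : ∀ (N : ℕ) (t : Fin N → ℝ) (ξ : Fin N → ℂ), ∑ i, ξ i = 0 →
    0 ≤ (∑ i, ∑ j, ξ i * starRingEnd ℂ (ξ j) * ψ (t i - t j)).re

/-- The representation of `ψ` by a drift `a`, a Gaussian variance `σ²`, and a Poisson part with
intensity `z` and jump distribution `r`, a probability measure on `ℝ \ {0}` with all moments. -/
structure HasLevyRepresentation (ψ : ℝ → ℂ) (a σ z : ℝ) (r : Measure ℝ) : Prop where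
  intensity_nonneg : 0 ≤ z
  isProbabilityMeasure : IsProbabilityMeasure r
  no_atom_zero : r {0} = 0
  moments : ∀ n : ℕ, Integrable (fun s : ℝ => s ^ n) r
  eq : ∀ t : ℝ, ψ t = Complex.I * a * t - (σ : ℂ) ^ 2 / 2 * (t : ℂ) ^ 2
    + z * ∫ s, (Complex.exp (Complex.I * s * t) - 1) ∂r

/-- The constant `c_n = (-i)^n ψ⁽ⁿ⁾(0)`. This number is real for a Lévy characteristic that is
smooth at `0`; the real part only serves to have it in `ℝ`. -/
def levyCoeff (ψ : ℝ → ℂ) (n : ℕ) : ℝ := ((-Complex.I) ^ n * iteratedDeriv n ψ 0).re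

/-! ### Convoluted Lévy noise -/

/-- The characteristic functional `h ↦ ⟨exp(i⟨h, ·⟩)⟩_ν`. -/
def charFunctional {d : ℕ} (ν : Measure (Tempered d)) (h : 𝓢(Space d, ℝ)) : ℂ :=
  ∫ φ, Complex.exp (Complex.I * (φ h : ℂ)) ∂ν

/-- `ν` is the law of `φ = g * η`, where `η` is the Lévy noise with characteristic `ψ`, i.e. with
`𝔼 exp(i η(f)) = exp (∫ ψ(f(z)) dz)`. Since `φ(h) = ∫∫ h(x) g(x - z) dx η(dz)`, the law is given by
`𝔼 exp(i φ(h)) = exp (∫ ψ(∫ g(x - z) h(x) dx) dz)`. -/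
def IsConvolutedLevyNoise {d : ℕ} (ν : Measure (Tempered d)) (ψ : ℝ → ℂ) (g : Space d → ℝ) :
    Prop :=
  ∀ h : 𝓢(Space d, ℝ),
    charFunctional ν h = Complex.exp (∫ z, ψ (∫ x, g (x - z) * h x))

/-- The distribution `φ` is given by the continuous function `f`. -/
def IsGivenBy {d : ℕ} (φ : Tempered d) (f : Space d → ℝ) : Prop :=
  Continuous f ∧ ∀ h : 𝓢(Space d, ℝ), HasCompactSupport (h : Space d → ℝ) →
    φ h = ∫ x, f x * h x

/-- `ν` is supported on continuous functions. -/
def SupportedOnContinuous {d : ℕ} (ν : Measure (Tempered d)) : Prop :=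
  ∀ᵐ φ ∂ν, ∃ f, IsGivenBy φ f

open Classical in
/-- The value `φ(x)` of the distribution `φ` at the point `x`: the value at `x` of the (unique)
continuous function that `φ` is given by, and zero if `φ` is not a continuous function. -/
def fieldAt {d : ℕ} (φ : Tempered d) (x : Space d) : ℝ :=
  if h : ∃ f, IsGivenBy φ f then h.choose x else 0

/-! ### Moments and truncated moments -/

section Truncation

variable {ι : Type*} [DecidableEq ι]

/-- Truncation of a family `M` of numbers indexed by finite sets, defined recursively by solving
`M J = ∑_{I partition of J} ∏_{B ∈ I} M^T B` for the term of the one-block partition. -/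
def truncation (M : Finset ι → ℝ) (J : Finset ι) : ℝ :=
  M J - ∑ I ∈ ({I | I.parts ≠ {J}} : Finset (Finpartition J)),
    ∏ B ∈ I.parts.attach, if _h : B.1 ⊂ J then truncation M B.1 else 1
termination_by J.card
decreasing_by exact Finset.card_lt_card _h

/-- The defining recursion of truncation. -/
theorem eq_sum_truncation (M : Finset ι → ℝ) (J : Finset ι) (hJ : J.Nonempty) :
    M J = ∑ I : Finpartition J, ∏ B ∈ I.parts, truncation M B := by
  classical
  have key : ∀ I ∈ ({I | I.parts ≠ {J}} : Finset (Finpartition J)),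
      (∏ B ∈ I.parts.attach, if _h : B.1 ⊂ J then truncation M B.1 else 1)
        = ∏ B ∈ I.parts, truncation M B := by
    intro I hI
    rw [← Finset.prod_attach I.parts (truncation M)]
    refine Finset.prod_congr rfl fun B _ => ?_
    have hle : B.1 ⊆ J := I.le B.2
    have hne : B.1 ≠ J := by
      intro h
      have hJmem : J ∈ I.parts := by
        have aux : ∀ C, C = J → C ∈ I.parts → J ∈ I.parts := by
          intro C hC hmem
          rwa [hC] at hmem
        exact aux B.1 h B.2
      refine (Finset.mem_filter.mp hI).2 ?_
      refine Finset.eq_singleton_iff_unique_mem.mpr ⟨hJmem, fun C hC => ?_⟩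
      by_contra hCJ
      have hd : Disjoint C J := I.disjoint hC hJmem hCJ
      have hCle : C ≤ J := I.le hC
      exact I.ne_bot hC (hd.eq_bot_of_le hCle)
    rw [dif_pos (hle.ssubset_of_ne hne)]
  have hT : truncation M J = M J
      - ∑ I ∈ ({I | I.parts ≠ {J}} : Finset (Finpartition J)),
        ∏ B ∈ I.parts, truncation M B := by
    rw [truncation, Finset.sum_congr rfl key]
  have hJ' : J ≠ ⊥ := hJ.ne_empty
  have hone : ({I | ¬ I.parts ≠ {J}} : Finset (Finpartition J))
      = {Finpartition.indiscrete hJ'} := by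
    ext I
    simp only [ne_eq, not_not, Finset.mem_filter, Finset.mem_univ, true_and,
      Finset.mem_singleton]
    constructor
    · intro h
      ext1
      rw [h]
      rfl
    · rintro rfl
      rfl
  rw [← Finset.sum_filter_add_sum_filter_not Finset.univ
    (fun I : Finpartition J => I.parts ≠ {J}), hone, Finset.sum_singleton,
    Finpartition.indiscrete_parts, Finset.prod_singleton, hT]
  ring

variable {d : ℕ}

/-- The moment `⟨J⟩ = ⟨∏_{j ∈ J} φ(x_j)⟩_ν`. -/
def moment (ν : Measure (Tempered d)) (x : ι → Space d) (J : Finset ι) : ℝ :=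
  ∫ φ, ∏ j ∈ J, fieldAt φ (x j) ∂ν

/-- The truncated moment `⟨J⟩^T = ⟨∏_{j ∈ J} φ(x_j)⟩^T_ν`. -/
def truncatedMoment (ν : Measure (Tempered d)) (x : ι → Space d) (J : Finset ι) : ℝ :=
  truncation (moment ν x) J

end Truncation

/-! ### Generalized Feynman graphs -/

/-- The legs of the full vertices: one for each of the `n` outer full vertices, and `p j` for the
`j`-th of the `m` inner full vertices. -/
abbrev Leg (n m : ℕ) (p : Fin m → ℕ) : Type := Fin n ⊕ (Σ j : Fin m, Fin (p j))

/-- A generalized `n`-point Feynman graph with `m` inner full vertices. The edges are in bijection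
with the legs of the full vertices; each edge joins its leg to an inner empty vertex, and every
empty vertex is met by an edge. The empty vertices are written with some numbering `0, …, k - 1`;
two graphs that differ by the numbering are the same drawing. -/
structure Graph (n m : ℕ) where
  /-- the number of legs of the inner full vertices -/
  type : Fin m → ℕ
  /-- the number `k` of inner empty vertices -/
  numEmpty : ℕ
  /-- the empty vertex that the edge at a given leg of a full vertex leads to -/
  emptyEnd : Leg n m type → Fin numEmpty
  surjective : Function.Surjective emptyEnd

/-- The graphs `𝓕(n,m,v)` of the interaction polynomial `v = ∑ λ_p φ^p`: every inner full vertex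
has a number `p` of legs with `1 ≤ p ≤ deg v` and `λ_p ≠ 0`. -/
def feynmanGraphs (v : Polynomial ℝ) (n m : ℕ) : Set (Graph n m) :=
  {G | ∀ j, 1 ≤ G.type j ∧ G.type j ≤ v.natDegree ∧ v.coeff (G.type j) ≠ 0}

namespace Graph

variable {n m d : ℕ} (G : Graph n m)

/-- The set of edges (given by the legs of full vertices) at the empty vertex `q`. -/
def edgesAt (q : Fin G.numEmpty) : Finset (Leg n m G.type) := {e | G.emptyEnd e = q}

/-- The point of the full vertex of a leg, if the outer full vertices have the values `x` and the
inner full vertices have the values `y`. -/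
def fullEnd (x : Fin n → Space d) (y : Fin m → Space d) : Leg n m G.type → Space d :=
  Sum.elim x fun e => y e.1

/-- The integrand of `𝓥_Λ[G]`: a truncated moment for each empty vertex, taken at the full vertex
points where its edges end, and a factor `λ_p` for each inner full vertex with `p` legs. -/
def integrand (ν : Measure (Tempered d)) (v : Polynomial ℝ) (x : Fin n → Space d)
    (y : Fin m → Space d) : ℝ :=
  (∏ q, truncatedMoment ν (G.fullEnd x y) (G.edgesAt q)) * ∏ j, v.coeff (G.type j)

/-- The value `𝓥_Λ[G](x_1, …, x_n)` given by the Feynman rules of a general measure. -/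
def value (ν : Measure (Tempered d)) (v : Polynomial ℝ) (Λ : Set (Space d))
    (x : Fin n → Space d) : ℝ :=
  ∫ y in Set.univ.pi fun _ : Fin m => Λ, G.integrand ν v x y

/-- The integrand of the Feynman rules with propagator `g` and constants `c`, with the values `y`
at the inner full vertices and `z` at the inner empty vertices: a propagator for each edge, a
factor `c_l` for each empty vertex with `l` legs, and a factor `λ_p` for each inner full vertex
with `p` legs. -/
def levyIntegrand (g : Space d → ℝ) (c : ℕ → ℝ) (v : Polynomial ℝ) (x : Fin n → Space d)
    (y : Fin m → Space d) (z : Fin G.numEmpty → Space d) : ℝ :=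
  (∏ e, g (G.fullEnd x y e - z (G.emptyEnd e))) * (∏ q, c (G.edgesAt q).card)
    * ∏ j, v.coeff (G.type j)

/-- The domain of integration of the inner vertices: `Λ` for the full ones and the whole space for
the empty ones. -/
def innerDomain (Λ : Set (Space d)) : Set ((Fin m → Space d) × (Fin G.numEmpty → Space d)) :=
  (Set.univ.pi fun _ => Λ) ×ˢ Set.univ

end Graph

end LevyFeynman

end

/-! The characteristic functional of `ν` is `exp K` with `K(k) = ∫ ψ(G_k)`, where `G_k` is `g`
smeared with the test function `k`. Formally, differentiating at `k = 0` in directions `h_1, …, h_l`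
gives the cumulant of the smeared fields `φ(h_j)`, namely `c_l ∫ ∏ G_{h_j}`, and letting the `h_j`
tend to delta functions gives the truncated moment at points.

The combinatorics runs through `CumulantRecursion`, which splits off the block of one distinguished
element instead of summing over all partitions. The recursion determines the truncation
(`CumulantRecursion.truncation_eq`), follows from the Leibniz rule applied to `Ψ = exp K`
(`cumulantRecursion_of_hasDerivAt`), and survives limits.

Moments of `φ(h)` are not given in advance. Near `s = 0` the function `s ↦ 𝔼 exp(i s φ(h))` is
smooth, because `ψ` is smooth near `0` and `G_h` is bounded and integrable. Symmetric differences of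
order `2n` and Fatou's lemma then produce the moment of order `2n`
(`integrable_pow_of_hasDerivAt_charFun`).

For the passage to points, mollified propagators converge in every `L^l` with `c_l ≠ 0`, so by
Hölder the cumulants converge. The recursion bounds all mollified moments; bounding the moments of a
doubled family of points is an `L²` bound for the products, which gives uniform integrability and
convergence of the moments.

In the Feynman rules each empty vertex contributes one integral over its own `z_q`. The product of
these integrals is an integral over all `z`, and Fubini applies because Hölder and translation
invariance bound the `z`-integral of the absolute value uniformly in `y`. -/

namespace LevyFeynman

/-! ### Partitions, moments and cumulants. -/

section Truncation

variable {ι : Type*} [DecidableEq ι]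

/-- The sum over all partitions, grouped by the block of a distinguished element. -/
theorem sum_finpartition_insert (T : Finset ι → ℝ) {k : ι} {J : Finset ι} (hk : k ∉ J) :
    ∑ I : Finpartition (insert k J), ∏ B ∈ I.parts, T B =
      ∑ A ∈ J.powerset, T (insert k A) * ∑ I : Finpartition (J \ A), ∏ B ∈ I.parts, T B := by
  classical
  have hmaps : ∀ I ∈ (Finset.univ : Finset (Finpartition (insert k J))),
      (I.part k).erase k ∈ J.powerset := by
    intro I _
    rw [Finset.mem_powerset]
    exact (Finset.erase_subset_erase k (I.part_subset k)).trans (Finset.erase_insert hk).subset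
  rw [← Finset.sum_fiberwise_of_maps_to hmaps]
  refine Finset.sum_congr rfl fun A hA => ?_
  rw [Finset.mem_powerset] at hA
  have hkA : k ∉ A := fun h => hk (hA h)
  have hsd : insert k J \ insert k A = J \ A := by
    ext y; simp only [Finset.mem_sdiff, Finset.mem_insert]
    constructor
    · rintro ⟨rfl | h1, h2⟩ <;> tauto
    · rintro ⟨h1, h2⟩
      exact ⟨Or.inr h1, by rintro (rfl | h) <;> tauto⟩
  have hpart : ∀ I : Finpartition (insert k J), (I.part k).erase k = A →
      insert k A ∈ I.parts := by
    intro I hI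
    have h1 : I.part k ∈ I.parts := I.part_mem.2 (Finset.mem_insert_self _ _)
    have h2 : k ∈ I.part k := I.mem_part_self.2 (Finset.mem_insert_self _ _)
    rwa [← hI, Finset.insert_erase h2]
  have hdisj : Disjoint (J \ A) (insert k A) := by
    rw [Finset.disjoint_left]
    intro y hy hy'
    rw [Finset.mem_sdiff] at hy
    rcases Finset.mem_insert.1 hy' with rfl | h
    · exact hk hy.1
    · exact hy.2 h
  have hunion : (J \ A) ⊔ insert k A = insert k J := by
    ext y
    simp only [Finset.sup_eq_union, Finset.mem_union, Finset.mem_sdiff, Finset.mem_insert]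
    constructor
    · rintro (h | rfl | h)
      · exact Or.inr h.1
      · exact Or.inl rfl
      · exact Or.inr (hA h)
    · rintro (rfl | h) <;> tauto
  have havoid : ∀ I : Finpartition (insert k J), insert k A ∈ I.parts →
      (I.avoid (insert k A)).parts = I.parts.erase (insert k A) := by
    intro I hI
    have hd : ∀ D ∈ I.parts, D ≠ insert k A → Disjoint D (insert k A) := fun D hD hne =>
      I.disjoint hD hI hne
    ext C
    rw [Finpartition.mem_avoid, Finset.mem_erase]
    constructor
    · rintro ⟨D, hD, hle, rfl⟩
      have hne : D ≠ insert k A := fun h => hle h.le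
      rw [Finset.sdiff_eq_self_of_disjoint (hd D hD hne)]
      exact ⟨hne, hD⟩
    · rintro ⟨hne, hC⟩
      refine ⟨C, hC, fun hle => ?_, Finset.sdiff_eq_self_of_disjoint (hd C hC hne)⟩
      exact I.ne_bot hC ((hd C hC hne).eq_bot_of_le hle)
  have hnotmem : ∀ I' : Finpartition (J \ A), insert k A ∉ I'.parts := by
    intro I' h
    have := I'.le h (Finset.mem_insert_self k A)
    exact hk (Finset.mem_sdiff.1 this).1
  rw [Finset.mul_sum]
  -- Partitions whose block at `k` is `insert k A` correspond to partitions of `J \ A`: delete that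
  -- block, or adjoin it.
  refine Finset.sum_bij' (fun I _ => (I.avoid (insert k A)).copy hsd)
    (fun I' _ => I'.extend (Finset.insert_ne_empty k A) hdisj hunion) ?_ ?_ ?_ ?_ ?_
  · intro I _; exact Finset.mem_univ _
  · intro I' _
    rw [Finset.mem_filter]
    refine ⟨Finset.mem_univ _, ?_⟩
    rw [Finpartition.part_eq_of_mem _ (t := insert k A) (by simp [Finpartition.extend])
      (Finset.mem_insert_self k A), Finset.erase_insert hkA]
  · intro I hI
    have hI' := hpart I (Finset.mem_filter.1 hI).2
    ext1
    change insert (insert k A) (I.avoid (insert k A)).parts = I.parts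
    rw [havoid I hI', Finset.insert_erase hI']
  · intro I' _
    ext1
    change (Finpartition.avoid _ _).parts = _
    rw [havoid _ (by simp [Finpartition.extend])]
    change (insert (insert k A) I'.parts).erase _ = _
    rw [Finset.erase_insert (hnotmem I')]
  · intro I hI
    have hI' := hpart I (Finset.mem_filter.1 hI).2
    change _ = T (insert k A) * ∏ B ∈ (I.avoid (insert k A)).parts, T B
    rw [havoid I hI', Finset.mul_prod_erase _ _ hI']

/-- `M` and `T` are related as moments and cumulants, in recursive form. -/
def CumulantRecursion {R : Type*} [CommSemiring R] (M T : Finset ι → R) : Prop :=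
  ∀ k J, k ∉ J → M (insert k J) = ∑ A ∈ J.powerset, T (insert k A) * M (J \ A)

theorem cumulantRecursion_truncation (M : Finset ι → ℝ) (h0 : M ∅ = 1) :
    CumulantRecursion M (truncation M) := by
  intro k J hk
  have hM : ∀ J, M J = ∑ I : Finpartition J, ∏ B ∈ I.parts, truncation M B := by
    intro J
    rcases J.eq_empty_or_nonempty with rfl | hJ
    · rw [h0]
      change 1 = ∑ I : Finpartition (⊥ : Finset ι), ∏ B ∈ I.parts, truncation M B
      rw [Fintype.sum_eq_single (Finpartition.empty (Finset ι))]
      · simp [Finpartition.empty]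
      · exact fun I hI => absurd (Subsingleton.elim I _) hI
    · exact eq_sum_truncation M J hJ
  rw [hM, sum_finpartition_insert _ hk]
  exact Finset.sum_congr rfl fun A _ => by rw [← hM]

/-- The recursion can be solved for `T`: the summand `A = J'` is `T (insert k J') * M ∅` with `M ∅ =
1`, and every other summand involves `T` only on smaller sets, where induction applies. -/
theorem CumulantRecursion.truncation_eq {M T : Finset ι → ℝ} (h0 : M ∅ = 1)
    (h : CumulantRecursion M T) (J : Finset ι) (hJ : J.Nonempty) : truncation M J = T J := by
  induction J using Finset.strongInduction with
  | H J ih =>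
    obtain ⟨k, hk⟩ := hJ
    obtain ⟨J', hkJ', rfl⟩ : ∃ J', k ∉ J' ∧ insert k J' = J :=
      ⟨J.erase k, Finset.notMem_erase k J, Finset.insert_erase hk⟩
    have h1 := cumulantRecursion_truncation M h0 k J' hkJ'
    rw [h k J' hkJ'] at h1
    rw [← Finset.sum_erase_add _ _ (Finset.mem_powerset_self J'),
      ← Finset.sum_erase_add _ _ (Finset.mem_powerset_self J')] at h1
    rw [Finset.sdiff_self, h0, mul_one, mul_one] at h1
    have h2 : ∑ A ∈ J'.powerset.erase J', T (insert k A) * M (J' \ A)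
        = ∑ A ∈ J'.powerset.erase J', truncation M (insert k A) * M (J' \ A) := by
      refine Finset.sum_congr rfl fun A hA => ?_
      rw [Finset.mem_erase, Finset.mem_powerset] at hA
      have hss : A ⊂ J' := hA.2.ssubset_of_ne hA.1
      rw [ih (insert k A) ?_ (Finset.insert_nonempty _ _)]
      refine Finset.ssubset_iff_subset_ne.2 ⟨Finset.insert_subset_insert _ hss.subset, fun he => ?_⟩
      have hkA : k ∉ A := fun h => hkJ' (hss.subset h)
      apply hss.ne
      rw [← Finset.erase_insert hkA, he, Finset.erase_insert hkJ']
    linarith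

end Truncation

end LevyFeynman

/-! ### Existence of moments from smoothness of the characteristic function. -/

namespace LevyFeynman

open Filter Topology

/-- Iterated finite differences are bounded by the derivative of the same order. -/
theorem norm_fwdDiff_iter_le {f : ℕ → ℝ → ℂ} {n : ℕ} {a b C h x : ℝ} (hh : 0 ≤ h)
    (hf : ∀ k < n, ∀ s ∈ Set.Ioo a b, HasDerivAt (f k) (f (k + 1) s) s)
    (hC : ∀ s ∈ Set.Ioo a b, ‖f n s‖ ≤ C) (hax : a < x) (hxb : x + n * h < b) :
    ‖(fwdDiff h)^[n] (f 0) x‖ ≤ C * h ^ n := by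
  induction n generalizing f b C with
  | zero => simpa using hC x ⟨hax, by simpa using hxb⟩
  | succ n ih =>
    rw [Function.iterate_succ_apply]
    have hsub : ∀ s ∈ Set.Ioo a (b - h), s ∈ Set.Ioo a b ∧ s + h ∈ Set.Ioo a b := fun s hs =>
      ⟨⟨hs.1, by linarith [hs.2]⟩, by linarith [hs.1], by linarith [hs.2]⟩
    -- The differences again form a chain of derivatives, on the interval shortened by `h`; the mean
    -- value inequality bounds the last one by `C * h`.
    have key := ih (f := fun k => fwdDiff h (f k)) (b := b - h) (C := C * h) ?_ ?_ ?_
    · calc _ ≤ C * h * h ^ n := key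
        _ = C * h ^ (n + 1) := by ring
    · intro k hk s hs
      exact ((hf k (by omega) _ (hsub s hs).2).comp_add_const s h).sub
        (hf k (by omega) _ (hsub s hs).1)
    · intro s hs
      have := (convex_Ioo a b).norm_image_sub_le_of_norm_hasDerivWithin_le
        (f := f n) (f' := f (n + 1)) (C := C)
        (fun y hy => (hf n (by omega) y hy).hasDerivWithinAt) hC (hsub s hs).1 (hsub s hs).2
      simpa [fwdDiff, abs_of_nonneg hh] using this
    · push_cast at hxb
      linarith

variable {Ω : Type*} [MeasurableSpace Ω] {μ : Measure Ω}

theorem norm_exp_I_mul (x y : ℝ) : ‖Complex.exp (Complex.I * (x * y : ℝ))‖ = 1 := by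
  rw [mul_comm]; exact Complex.norm_exp_ofReal_mul_I _

/-- A shift of `s` by `h` multiplies the exponential by `exp(i h X)`, so each difference contributes
a factor `exp(i h X) - 1`. -/
theorem fwdDiff_iter_integral_exp [IsFiniteMeasure μ] {X : Ω → ℝ} (hX : AEMeasurable X μ)
    (h : ℝ) (n : ℕ) :
    (fwdDiff h)^[n] (fun s : ℝ => ∫ w, Complex.exp (Complex.I * (s * X w : ℝ)) ∂μ) =
      fun s : ℝ => ∫ w, (Complex.exp (Complex.I * (h * X w : ℝ)) - 1) ^ n
        * Complex.exp (Complex.I * (s * X w : ℝ)) ∂μ := by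
  induction n with
  | zero => simp
  | succ n ih =>
    rw [Function.iterate_succ_apply', ih]
    have hmeas : ∀ s : ℝ, AEStronglyMeasurable
        (fun w => Complex.exp (Complex.I * (s * X w : ℝ))) μ := fun s => by
      have : AEMeasurable (fun w => Complex.exp (Complex.I * (s * X w : ℝ))) μ := by fun_prop
      exact this.aestronglyMeasurable
    have hint : ∀ s : ℝ, Integrable (fun w => (Complex.exp (Complex.I * (h * X w : ℝ)) - 1) ^ n
        * Complex.exp (Complex.I * (s * X w : ℝ))) μ := fun s => by
      refine Integrable.of_bound ((((hmeas h).sub aestronglyMeasurable_const).pow n).mul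
        (hmeas s)) (2 ^ n) (Eventually.of_forall fun w => ?_)
      rw [norm_mul, norm_exp_I_mul, mul_one, norm_pow]
      gcongr
      calc _ ≤ ‖Complex.exp (Complex.I * (h * X w : ℝ))‖ + ‖(1 : ℂ)‖ := norm_sub_le _ _
        _ = 2 := by rw [norm_exp_I_mul, norm_one]; norm_num
    funext s
    rw [fwdDiff, ← integral_sub (hint _) (hint _)]
    refine integral_congr_ae (Eventually.of_forall fun w => ?_)
    have : Complex.exp (Complex.I * ((s + h) * X w : ℝ)) =
        Complex.exp (Complex.I * (h * X w : ℝ)) * Complex.exp (Complex.I * (s * X w : ℝ)) := by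
      rw [← Complex.exp_add]; congr 1; push_cast; ring
    simp only [this]
    ring

/-- Since `exp(iθ) - 1 = exp(iθ/2) · 2i sin(θ/2)`, centring the difference of order `2n` at zero
removes the phase. What remains is real with the fixed sign `(-1)^n`, so a bound on the difference
bounds the integral of a nonnegative function. -/
theorem exp_sub_one_pow_mul_exp (θ : ℝ) (n : ℕ) :
    (Complex.exp (Complex.I * θ) - 1) ^ (2 * n) * Complex.exp (Complex.I * (-(n : ℝ) * θ : ℝ)) =
      (-1) ^ n * (((2 * Real.sin (θ / 2)) ^ (2 * n) : ℝ) : ℂ) := by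
  have h1 : Complex.exp (Complex.I * (-(n : ℝ) * θ : ℝ)) =
      Complex.exp (-(Complex.I * (θ / 2))) ^ (2 * n) := by
    rw [← Complex.exp_nat_mul]; congr 1; push_cast; ring
  have h2 : (Complex.exp (Complex.I * θ) - 1) * Complex.exp (-(Complex.I * (θ / 2))) =
      Complex.I * (2 * Complex.sin (θ / 2)) := by
    rw [sub_mul, ← Complex.exp_add, one_mul, Complex.sin]
    have h3 : Complex.I * θ + -(Complex.I * (θ / 2)) = (θ / 2 : ℂ) * Complex.I := by ring
    have h4 : -(Complex.I * (θ / 2)) = -(θ / 2 : ℂ) * Complex.I := by ring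
    rw [h3, h4]
    linear_combination (-(Complex.exp (-(θ / 2 : ℂ) * Complex.I)
      - Complex.exp ((θ / 2 : ℂ) * Complex.I))) * Complex.I_sq
  rw [h1, ← mul_pow, h2, mul_pow, pow_mul, Complex.I_sq]
  push_cast
  rfl

/-- Fatou's lemma, in the form that yields integrability of the limit. -/
theorem integrable_of_tendsto_of_integral_le {F : ℕ → Ω → ℝ} {f : Ω → ℝ} {C : ℝ}
    (hF : ∀ n, Integrable (F n) μ) (hF0 : ∀ n w, 0 ≤ F n w)
    (hC : ∀ᶠ n in atTop, ∫ w, F n w ∂μ ≤ C)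
    (hlim : ∀ᵐ w ∂μ, Tendsto (fun n => F n w) atTop (𝓝 (f w))) : Integrable f μ := by
  have hfm : AEStronglyMeasurable f μ :=
    aestronglyMeasurable_of_tendsto_ae atTop (fun n => (hF n).aestronglyMeasurable) hlim
  refine ⟨hfm, ?_⟩
  have h1 : ∫⁻ w, ‖f w‖ₑ ∂μ ≤ liminf (fun n => ∫⁻ w, ‖F n w‖ₑ ∂μ) atTop := by
    calc ∫⁻ w, ‖f w‖ₑ ∂μ = ∫⁻ w, liminf (fun n => ‖F n w‖ₑ) atTop ∂μ := by
          refine lintegral_congr_ae ?_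
          filter_upwards [hlim] with w hw
          exact ((continuous_enorm.tendsto _).comp hw).liminf_eq.symm
      _ ≤ _ := lintegral_liminf_le' fun n => (hF n).aestronglyMeasurable.enorm
  refine (h1.trans (c := ENNReal.ofReal C) ?_).trans_lt ENNReal.ofReal_lt_top
  refine liminf_le_of_frequently_le' (Eventually.frequently ?_)
  filter_upwards [hC] with n hn
  rw [← ofReal_integral_norm_eq_lintegral_enorm (hF n)]
  refine ENNReal.ofReal_le_ofReal (le_trans (le_of_eq ?_) hn)
  exact integral_congr_ae (Eventually.of_forall fun w => by simp [abs_of_nonneg (hF0 n w)])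

/-- If the characteristic function of `X` is `2n` times differentiable at zero, then `X` has a
moment of order `2n`. -/
theorem integrable_pow_of_hasDerivAt_charFun [IsFiniteMeasure μ] {X : Ω → ℝ}
    (hX : AEMeasurable X μ) {n : ℕ} {f : ℕ → ℝ → ℂ} {δ C : ℝ} (hδ : 0 < δ)
    (hf0 : ∀ s ∈ Set.Ioo (-δ) δ, f 0 s = ∫ w, Complex.exp (Complex.I * (s * X w : ℝ)) ∂μ)
    (hf : ∀ k < 2 * n, ∀ s ∈ Set.Ioo (-δ) δ, HasDerivAt (f k) (f (k + 1) s) s)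
    (hC : ∀ s ∈ Set.Ioo (-δ) δ, ‖f (2 * n) s‖ ≤ C) :
    Integrable (fun w => X w ^ (2 * n)) μ := by
  set h : ℕ → ℝ := fun m => 1 / ((m : ℝ) + 1) with hh
  have hpos : ∀ m, 0 < h m := fun m => by positivity
  have hh0 : Tendsto h atTop (𝓝 0) := tendsto_one_div_add_atTop_nhds_zero_nat
  refine integrable_of_tendsto_of_integral_le (C := C)
    (F := fun m w => (2 * Real.sin (h m * X w / 2) / h m) ^ (2 * n)) ?_ ?_ ?_ ?_
  · intro m
    refine Integrable.of_bound (C := (2 / h m) ^ (2 * n)) ?_ (Eventually.of_forall fun w => ?_)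
    · have : AEMeasurable (fun w => (2 * Real.sin (h m * X w / 2) / h m) ^ (2 * n)) μ := by
        fun_prop
      exact this.aestronglyMeasurable
    · rw [norm_pow]
      gcongr
      rw [norm_div, norm_mul, Real.norm_of_nonneg (hpos m).le, Real.norm_ofNat]
      refine div_le_div_of_nonneg_right ?_ (hpos m).le
      nlinarith [Real.abs_sin_le_one (h m * X w / 2), Real.norm_eq_abs (Real.sin (h m * X w / 2))]
  · intro m w
    exact Even.pow_nonneg (even_two_mul n) _
  -- Starting at `-n h`, the difference of order `2n` uses the nodes from `-n h` to `n h`, which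
  -- must lie where `f 0` is the characteristic function.
  · have hev : ∀ᶠ m in atTop, n * h m < δ := by
      have : Tendsto (fun m => n * h m) atTop (𝓝 0) := by simpa using hh0.const_mul (n : ℝ)
      exact this.eventually_lt_const hδ
    filter_upwards [hev] with m hm
    have h1 := norm_fwdDiff_iter_le (x := -(n : ℝ) * h m) (hpos m).le hf hC (by linarith)
      (by push_cast; linarith)
    have h2 : (fwdDiff (h m))^[2 * n] (f 0) (-(n : ℝ) * h m) =
        (fwdDiff (h m))^[2 * n] (fun s : ℝ => ∫ w, Complex.exp (Complex.I * (s * X w : ℝ)) ∂μ)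
          (-(n : ℝ) * h m) := by
      rw [fwdDiff_iter_eq_sum_shift, fwdDiff_iter_eq_sum_shift]
      refine Finset.sum_congr rfl fun k hk => ?_
      have hk' : (k : ℝ) ≤ 2 * n := by
        have := Finset.mem_range_succ_iff.1 hk; exact_mod_cast this
      rw [hf0 _ ?_]
      rw [nsmul_eq_mul]
      constructor
      · nlinarith [hpos m, Nat.cast_nonneg (α := ℝ) k]
      · nlinarith [hpos m]
    rw [h2, fwdDiff_iter_integral_exp hX] at h1
    have h3 : ∫ w, (Complex.exp (Complex.I * (h m * X w : ℝ)) - 1) ^ (2 * n)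
        * Complex.exp (Complex.I * (-(n : ℝ) * h m * X w : ℝ)) ∂μ =
        (-1) ^ n * ((∫ w, (2 * Real.sin (h m * X w / 2)) ^ (2 * n) ∂μ : ℝ) : ℂ) := by
      rw [← integral_complex_ofReal, ← integral_const_mul]
      refine integral_congr_ae (Eventually.of_forall fun w => ?_)
      have := exp_sub_one_pow_mul_exp (h m * X w) n
      rw [← mul_assoc] at this
      exact this
    dsimp only at h1
    rw [h3, norm_mul, norm_pow, norm_neg, norm_one, one_pow, one_mul, Complex.norm_real,
      Real.norm_of_nonneg (integral_nonneg fun w => Even.pow_nonneg (even_two_mul n) _)] at h1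
    simp only [div_pow]
    rw [integral_div, div_le_iff₀ (pow_pos (hpos m) _)]
    exact h1
  · refine Eventually.of_forall fun w => ?_
    -- The pointwise limit `2 sin(h X / 2) / h → X` is a derivative at zero.
    have hd : HasDerivAt (fun t : ℝ => 2 * Real.sin (t * X w / 2)) (X w) 0 := by
      have h1 : HasDerivAt (fun t : ℝ => t * X w / 2) (X w / 2) 0 := by
        simpa using ((hasDerivAt_id (0 : ℝ)).mul_const (X w)).div_const 2
      have := (h1.sin).const_mul 2
      refine this.congr_deriv ?_
      simp only [zero_mul, zero_div, Real.cos_zero]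
      ring
    have h4 := hd.tendsto_slope
    have h5 : Tendsto h atTop (𝓝[≠] 0) :=
      tendsto_nhdsWithin_iff.2 ⟨hh0, Eventually.of_forall fun m => (hpos m).ne'⟩
    have h6 := (h4.comp h5).pow (2 * n)
    refine h6.congr fun m => ?_
    simp [slope_def_field]

theorem memLp_mul_of_forall {X Y : Ω → ℝ} (hX : ∀ p : ℕ, MemLp X p μ)
    (hY : ∀ p : ℕ, MemLp Y p μ) (p : ℕ) : MemLp (fun w => X w * Y w) p μ := by
  refine (hY (2 * p)).mul (hX (2 * p)) (hpqr := ⟨?_⟩)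
  push_cast
  rw [ENNReal.mul_inv (by simp) (by simp), ← add_mul, ENNReal.inv_two_add_inv_two, one_mul]

theorem memLp_prod_of_forall [IsFiniteMeasure μ] {ι : Type*} {X : ι → Ω → ℝ}
    (hX : ∀ i, ∀ p : ℕ, MemLp (X i) p μ) (J : Finset ι) (p : ℕ) :
    MemLp (fun w => ∏ j ∈ J, X j w) p μ := by
  classical
  induction J using Finset.induction generalizing p with
  | empty => simpa using memLp_const (1 : ℝ)
  | insert k J hk ih =>
    simp only [Finset.prod_insert hk]
    exact memLp_mul_of_forall (hX k) ih p

theorem memLp_of_integrable_pow_even [IsFiniteMeasure μ] {X : Ω → ℝ} (hX : AEStronglyMeasurable X μ)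
    (h : ∀ n : ℕ, Integrable (fun w => X w ^ (2 * n)) μ) (p : ℕ) : MemLp X p μ := by
  -- An even exponent that is at least `p` and, also for `p = 0`, nonzero.
  have h1 : MemLp X ((2 * (p + 1) : ℕ) : ℝ≥0∞) μ := by
    rw [← integrable_norm_rpow_iff hX (by simp) (ENNReal.natCast_ne_top _)]
    refine (h (p + 1)).congr (Eventually.of_forall fun w => ?_)
    simp only [ENNReal.toReal_natCast, Real.rpow_natCast, Real.norm_eq_abs]
    exact ((even_two_mul _).pow_abs _).symm
  exact h1.mono_exponent (by exact_mod_cast (by omega))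

end LevyFeynman

/-! ### Differentiation under the integral sign and the derivatives of an exponential. -/

namespace LevyFeynman

open Filter Topology

theorem _root_.ContDiffAt.contDiffAt_iteratedDeriv {f : ℝ → ℂ} {x : ℝ} {n m a : ℕ}
    (hf : ContDiffAt ℝ n f x) (h : m + a ≤ n) : ContDiffAt ℝ m (iteratedDeriv a f) x := by
  rw [iteratedDeriv_eq_equiv_comp]
  exact (ContinuousMultilinearMap.piFieldEquiv ℝ (Fin a) ℂ).symm.contDiff.contDiffAt.comp x
    (hf.iteratedFDeriv_right (m := (m : ℕ)) (i := a) (by exact_mod_cast h))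

/-- A function that is `C^n` at zero has bounded derivatives up to order `n` near zero. -/
theorem exists_hasDerivAt_iteratedDeriv {f : ℝ → ℂ} {n : ℕ} (hf : ContDiffAt ℝ n f 0) :
    ∃ δ > 0, ∃ C, (∀ a < n, ∀ u, |u| < δ →
      HasDerivAt (iteratedDeriv a f) (iteratedDeriv (a + 1) f u) u) ∧
      ∀ a ≤ n, ∀ u, |u| < δ → ‖iteratedDeriv a f u‖ ≤ C := by
  have h1 : ∀ᶠ u in 𝓝 (0 : ℝ), ContDiffAt ℝ n f u := hf.eventually (by simp)
  have h2 : ∀ᶠ u in 𝓝 (0 : ℝ), ∀ a ∈ Finset.range (n + 1),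
      ‖iteratedDeriv a f u‖ < ‖iteratedDeriv a f 0‖ + 1 := by
    rw [Filter.eventually_all_finset]
    intro a ha
    have : ContDiffAt ℝ (0 : ℕ) (iteratedDeriv a f) 0 := hf.contDiffAt_iteratedDeriv
      (by have := Finset.mem_range_succ_iff.1 ha; omega)
    exact this.continuousAt.norm.eventually_lt_const (by linarith)
  obtain ⟨δ, hδ, h⟩ := Metric.eventually_nhds_iff.1 (h1.and h2)
  -- The sum serves as a single bound for all orders at once.
  refine ⟨δ, hδ, ∑ a ∈ Finset.range (n + 1), (‖iteratedDeriv a f 0‖ + 1), ?_, ?_⟩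
  · intro a ha u hu
    have h3 := (h (y := u) (by simpa using hu)).1
    have h4 : ContDiffAt ℝ (1 : ℕ) (iteratedDeriv a f) u :=
      h3.contDiffAt_iteratedDeriv (by omega)
    rw [iteratedDeriv_succ]
    exact (h4.differentiableAt (by simp)).hasDerivAt
  · intro a ha u hu
    have ha' : a ∈ Finset.range (n + 1) := Finset.mem_range_succ_iff.2 ha
    refine ((h (y := u) (by simpa using hu)).2 a ha').le.trans ?_
    exact Finset.single_le_sum (f := fun a => ‖iteratedDeriv a f 0‖ + 1)
      (fun _ _ => by positivity) ha'

theorem contDiffOn_of_hasDerivAt {f : ℕ → ℝ → ℂ} {n : ℕ} {U : Set ℝ} (hU : IsOpen U)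
    (hf : ∀ k < n, ∀ s ∈ U, HasDerivAt (f k) (f (k + 1) s) s) (hc : ContinuousOn (f n) U) :
    ContDiffOn ℝ n (f 0) U := by
  induction n generalizing f with
  | zero => exact_mod_cast contDiffOn_zero.2 hc
  | succ n ih =>
    have h := ih (f := fun k => f (k + 1)) (fun k hk s hs => hf (k + 1) (by omega) s hs) hc
    push_cast
    rw [contDiffOn_succ_iff_deriv_of_isOpen hU]
    refine ⟨fun s hs => (hf 0 (by omega) s hs).differentiableAt.differentiableWithinAt,
      by simp, h.congr fun s hs => (hf 0 (by omega) s hs).deriv⟩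

/-- `ψ` is smooth only near zero, yet its iterated derivatives are composed with functions on all of
`ℝ^d`; global measurability avoids any localization. -/
theorem measurable_iteratedDeriv {f : ℝ → ℂ} (hf : Continuous f) (a : ℕ) :
    Measurable (iteratedDeriv a f) := by
  cases a with
  | zero => simpa using hf.measurable
  | succ a => rw [iteratedDeriv_succ]; exact measurable_deriv _

variable {E : Type*} [MeasurableSpace E] {μ : Measure E}

theorem integrable_comp_mul {F : ℝ → ℂ} {δ C : ℝ}
    (hC : ∀ u, |u| < δ → ‖F u‖ ≤ C) (hF : Measurable F) {H W : E → ℝ}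
    (hH : AEMeasurable H μ) (hHb : ∀ z, |H z| < δ) (hW : Integrable W μ) :
    Integrable (fun z => F (H z) * W z) μ :=
  hW.ofReal.bdd_mul (hF.comp_aemeasurable hH).aestronglyMeasurable
    (Eventually.of_forall fun z => hC _ (hHb z))

theorem hasDerivAt_integral_comp {F F' : ℝ → ℂ} {δ b C M : ℝ}
    (hF : ∀ u, |u| < δ → HasDerivAt F (F' u) u) (hC : ∀ u, |u| < δ → ‖F' u‖ ≤ C)
    (hFm : Measurable F) (hFm' : Measurable F') {H G W : E → ℝ} (hH : AEMeasurable H μ)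
    (hG : AEMeasurable G μ) (hW : AEMeasurable W μ) (hb : b < δ)
    (hHb : ∀ z, |H z| ≤ b) (hGb : ∀ z, |G z| ≤ M) (hGW : Integrable (fun z => G z * W z) μ)
    (hint : Integrable (fun z => F (H z) * W z) μ) :
    HasDerivAt (fun s : ℝ => ∫ z, F (H z + s * G z) * W z ∂μ)
      (∫ z, F' (H z) * (G z * W z : ℝ) ∂μ) 0 := by
  rcases isEmpty_or_nonempty E with hE | ⟨⟨z₀⟩⟩
  · have : μ = 0 := Measure.eq_zero_of_isEmpty μ
    simpa [this] using hasDerivAt_const (0 : ℝ) (0 : ℂ)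
  have hM : 0 ≤ M := (abs_nonneg _).trans (hGb z₀)
  -- For `|s|` below this radius, `|H + s G| ≤ b + |s| M < δ`; the `+ 1` covers `M = 0`.
  have hε : 0 < (δ - b) / (M + 1) := div_pos (by linarith) (by linarith)
  have hbound : ∀ z, ∀ s ∈ Metric.ball (0 : ℝ) ((δ - b) / (M + 1)), |H z + s * G z| < δ := by
    intro z s hs
    rw [mem_ball_zero_iff, Real.norm_eq_abs, lt_div_iff₀ (by linarith)] at hs
    calc |H z + s * G z| ≤ |H z| + |s| * |G z| := by
          rw [← abs_mul]; exact abs_add_le _ _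
      _ ≤ b + |s| * M := by gcongr; exacts [hHb z, hGb z]
      _ < δ := by nlinarith [abs_nonneg s]
  have hm : ∀ (F : ℝ → ℂ), Measurable F → ∀ (s : ℝ) (V : E → ℝ), AEMeasurable V μ →
      AEStronglyMeasurable (fun z => F (H z + s * G z) * V z) μ := by
    intro F hF s V hV
    have : AEMeasurable (fun z => F (H z + s * G z)) μ :=
      hF.comp_aemeasurable (hH.add (hG.const_mul s))
    exact (this.mul hV.complex_ofReal).aestronglyMeasurable
  have key := hasDerivAt_integral_of_dominated_loc_of_deriv_le (μ := μ) (x₀ := (0 : ℝ))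
    (F := fun s z => F (H z + s * G z) * W z)
    (F' := fun s z => F' (H z + s * G z) * (G z * W z : ℝ))
    (bound := fun z => C * |G z * W z|) (Metric.ball_mem_nhds 0 hε)
    (Eventually.of_forall fun s => hm F hFm s W hW) (by simpa using hint)
    (hm F' hFm' 0 _ (hG.mul hW)) (Eventually.of_forall fun z s hs => ?_)
    (hGW.abs.const_mul C) (Eventually.of_forall fun z s hs => ?_)
  · simpa using key.2
  · rw [norm_mul, Complex.norm_real, Real.norm_eq_abs]
    gcongr
    exact hC _ (hbound z s hs)
  · have h1 : HasDerivAt (fun s : ℝ => H z + s * G z) (G z) s := by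
      simpa using ((hasDerivAt_id s).mul_const (G z)).const_add (H z)
    have h2 := ((hF _ (hbound z s hs)).scomp s h1).mul_const (W z : ℂ)
    refine h2.congr_deriv ?_
    rw [Complex.real_smul]
    push_cast
    ring

theorem hasDerivAt_integral_mul_exp {X Y : E → ℝ} {W : E → ℂ} (hX : AEMeasurable X μ)
    (hY : AEMeasurable Y μ) (hW : Integrable W μ) (hWX : Integrable (fun z => (X z : ℂ) * W z) μ) :
    HasDerivAt (fun s : ℝ => ∫ z, W z * Complex.exp (Complex.I * (Y z + s * X z : ℝ)) ∂μ)
      (∫ z, (Complex.I * X z * W z) * Complex.exp (Complex.I * (Y z : ℝ)) ∂μ) 0 := by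
  have hexp : ∀ s : ℝ, AEStronglyMeasurable
      (fun z => Complex.exp (Complex.I * (Y z + s * X z : ℝ))) μ := fun s => by
    have : AEMeasurable (fun z => Complex.exp (Complex.I * (Y z + s * X z : ℝ))) μ := by fun_prop
    exact this.aestronglyMeasurable
  have hnorm : ∀ r : ℝ, ‖Complex.exp (Complex.I * (r : ℝ))‖ = 1 := fun r => by
    rw [mul_comm]; exact Complex.norm_exp_ofReal_mul_I _
  have key := hasDerivAt_integral_of_dominated_loc_of_deriv_le (μ := μ) (x₀ := (0 : ℝ))
    (F := fun s z => W z * Complex.exp (Complex.I * (Y z + s * X z : ℝ)))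
    (F' := fun s z => (Complex.I * (X z * W z)) * Complex.exp (Complex.I * (Y z + s * X z : ℝ)))
    (bound := fun z => ‖(X z : ℂ) * W z‖) (Metric.ball_mem_nhds 0 one_pos)
    (Eventually.of_forall fun s => hW.aestronglyMeasurable.mul (hexp s)) ?_
    ((hWX.aestronglyMeasurable.const_mul _).mul (hexp 0)) (Eventually.of_forall fun z s hs => ?_)
    hWX.norm (Eventually.of_forall fun z s hs => ?_)
  · simpa [mul_assoc] using key.2
  · exact hW.mul_bdd (hexp 0) (Eventually.of_forall fun z => (hnorm _).le)
  · rw [norm_mul, hnorm, mul_one, norm_mul, Complex.norm_I, one_mul]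
  · have h1 : HasDerivAt (fun s : ℝ => Y z + s * X z) (X z) s := by
      simpa using ((hasDerivAt_id s).mul_const (X z)).const_add (Y z)
    have h2 := ((h1.ofReal_comp.const_mul Complex.I).cexp).const_mul (W z)
    refine h2.congr_deriv ?_
    ring

/-- If `Ψ = exp K`, then the mixed derivatives of `Ψ` and `K` are related as moments and
cumulants. -/
theorem cumulantRecursion_of_hasDerivAt {V ι : Type*} [AddCommGroup V] [Module ℝ V]
    [DecidableEq ι] {U : Set V} {e : ι → V} {Ψ K : Finset ι → V → ℂ}
    (hU : ∀ k ∈ U, ∀ j, ∀ᶠ s : ℝ in 𝓝 0, k + s • e j ∈ U)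
    (hK : ∀ A j, j ∉ A → ∀ k ∈ U, HasDerivAt (fun s : ℝ => K A (k + s • e j)) (K (insert j A) k) 0)
    (hΨ : ∀ A j, j ∉ A → ∀ k ∈ U, HasDerivAt (fun s : ℝ => Ψ A (k + s • e j)) (Ψ (insert j A) k) 0)
    (h0 : ∀ k ∈ U, Ψ ∅ k = Complex.exp (K ∅ k)) {k : V} (hk : k ∈ U) :
    CumulantRecursion (fun A => Ψ A k) (fun A => K A k) := by
  intro j J hj
  dsimp only
  induction J using Finset.induction generalizing k with
  | empty =>
    have h1 := hΨ ∅ j (Finset.notMem_empty j) k hk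
    have h2 := (hK ∅ j (Finset.notMem_empty j) k hk).cexp
    have h3 : (fun s : ℝ => Ψ ∅ (k + s • e j)) =ᶠ[𝓝 0]
        fun s : ℝ => Complex.exp (K ∅ (k + s • e j)) := by
      filter_upwards [hU k hk j] with s hs using h0 _ hs
    rw [h1.unique (h2.congr_of_eventuallyEq h3)]
    simp [h0 k hk, mul_comm]
  | insert b J hb ih =>
    rw [Finset.mem_insert, not_or] at hj
    have hjb : b ∉ insert j J := by
      rw [Finset.mem_insert, not_or]; exact ⟨Ne.symm hj.1, hb⟩
    have h1 := hΨ (insert j J) b hjb k hk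
    -- The identity for `J` holds at all points of `U`, hence can be differentiated in direction `e
    -- b`. By the Leibniz rule `b` joins either the block of `j` or the remaining factor, matching
    -- the subsets of `insert b J` with and without `b`.
    have h3 : (fun s : ℝ => Ψ (insert j J) (k + s • e b)) =ᶠ[𝓝 0] fun s : ℝ =>
        ∑ A ∈ J.powerset, K (insert j A) (k + s • e b) * Ψ (J \ A) (k + s • e b) := by
      filter_upwards [hU k hk b] with s hs using ih hs hj.2
    have h2 : HasDerivAt (fun s : ℝ =>
        ∑ A ∈ J.powerset, K (insert j A) (k + s • e b) * Ψ (J \ A) (k + s • e b))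
        (∑ A ∈ J.powerset, (K (insert b (insert j A)) k * Ψ (J \ A) k +
          K (insert j A) k * Ψ (insert b (J \ A)) k)) 0 := by
      refine HasDerivAt.fun_sum fun A hA => ?_
      rw [Finset.mem_powerset] at hA
      have hbA : b ∉ insert j A := fun h => hjb (Finset.insert_subset_insert j hA h)
      have hbJ : b ∉ J \ A := fun h => hb (Finset.sdiff_subset h)
      have := (hK _ b hbA k hk).fun_mul (hΨ _ b hbJ k hk)
      simpa using this
    rw [Finset.insert_comm, h1.unique (h2.congr_of_eventuallyEq h3),
      Finset.sum_powerset_insert hb, Finset.sum_add_distrib, add_comm]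
    congr 1
    · refine Finset.sum_congr rfl fun A hA => ?_
      rw [Finset.mem_powerset] at hA
      rw [Finset.insert_sdiff_of_notMem _ fun h => hb (hA h)]
    · refine Finset.sum_congr rfl fun A hA => ?_
      rw [Finset.mem_powerset] at hA
      rw [Finset.insert_comm, Finset.insert_sdiff_insert,
        Finset.sdiff_insert_of_notMem hb]

end LevyFeynman

namespace LevyFeynman

open Filter Topology

/-! ### The coefficients -/

/-- Differentiating the hermitian symmetry `l` times at zero gives `(-1)^l ψ⁽ˡ⁾(0) = conj ψ⁽ˡ⁾(0)`,
so `(-i)^l ψ⁽ˡ⁾(0)` is its own conjugate. -/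
theorem ofReal_levyCoeff {ψ : ℝ → ℂ} (hψ : ∀ t, ψ (-t) = starRingEnd ℂ (ψ t)) (l : ℕ) :
    (levyCoeff ψ l : ℂ) = (-Complex.I) ^ l * iteratedDeriv l ψ 0 := by
  have h1 : ∀ t, iteratedDeriv l (fun t => starRingEnd ℂ (ψ t)) t =
      starRingEnd ℂ (iteratedDeriv l ψ t) := by
    induction l with
    | zero => simp
    | succ l ih =>
      intro t
      rw [iteratedDeriv_succ, iteratedDeriv_succ, funext ih]
      exact deriv.star
  have h2 : (-1 : ℂ) ^ l * iteratedDeriv l ψ 0 = starRingEnd ℂ (iteratedDeriv l ψ 0) := by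
    rw [← h1, ← funext hψ, iteratedDeriv_comp_neg]
    simp
  rw [levyCoeff]
  refine Complex.conj_eq_iff_re.1 ?_
  rw [map_mul, map_pow, map_neg, Complex.conj_I, neg_neg, ← h2, ← mul_assoc, ← mul_pow]
  simp

theorem iteratedDeriv_eq_levyCoeff {ψ : ℝ → ℂ} (hψ : ∀ t, ψ (-t) = starRingEnd ℂ (ψ t)) (l : ℕ) :
    iteratedDeriv l ψ 0 = Complex.I ^ l * levyCoeff ψ l := by
  rw [ofReal_levyCoeff hψ, ← mul_assoc, ← mul_pow]
  simp

/-! ### Smeared propagators -/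

variable {d : ℕ}

/-- The smeared propagator `z ↦ ∫ g(x - z) h(x) dx`. -/
noncomputable def smear (g : Space d → ℝ) (h : 𝓢(Space d, ℝ)) (z : Space d) : ℝ :=
  ∫ x, g (x - z) * h x

variable {g : Space d → ℝ}

theorem exists_norm_le (h : 𝓢(Space d, ℝ)) : ∃ C, ∀ x, ‖h x‖ ≤ C :=
  ⟨_, h.toBoundedContinuousFunction.norm_coe_le_norm⟩

theorem integrable_smear_integrand (hg : Integrable g) (h : 𝓢(Space d, ℝ)) (z : Space d) :
    Integrable (fun x => g (x - z) * h x) := by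
  obtain ⟨C, hC⟩ := exists_norm_le h
  exact (hg.comp_sub_right z).mul_bdd h.continuous.aestronglyMeasurable
    (Eventually.of_forall hC)

theorem smear_eq_convolution (g : Space d → ℝ) (h : 𝓢(Space d, ℝ)) :
    smear g h = MeasureTheory.convolution h (fun y => g (-y)) (ContinuousLinearMap.mul ℝ ℝ)
      volume := by
  funext z
  simp [smear, MeasureTheory.convolution, mul_comm]

theorem continuous_smear (hg : Integrable g) (h : 𝓢(Space d, ℝ)) : Continuous (smear g h) := by
  obtain ⟨C, hC⟩ := exists_norm_le h
  rw [smear_eq_convolution]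
  exact BddAbove.continuous_convolution_left_of_integrable _
    ⟨C, by rintro _ ⟨x, rfl⟩; exact hC x⟩ h.continuous hg.comp_neg

theorem integrable_smear (hg : Integrable g) (h : 𝓢(Space d, ℝ)) : Integrable (smear g h) := by
  rw [smear_eq_convolution]
  exact (h.integrable).integrable_convolution _ hg.comp_neg

theorem exists_abs_smear_le (hg : Integrable g) (h : 𝓢(Space d, ℝ)) :
    ∃ M, 0 ≤ M ∧ ∀ z, |smear g h z| ≤ M := by
  obtain ⟨C, hC⟩ := exists_norm_le h
  have hC0 : 0 ≤ C := (norm_nonneg _).trans (hC 0)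
  refine ⟨(∫ x, ‖g x‖) * C, mul_nonneg (integral_nonneg fun _ => norm_nonneg _) hC0, fun z => ?_⟩
  calc |smear g h z| ≤ ∫ x, ‖g (x - z) * h x‖ :=
        norm_integral_le_integral_norm (fun x => g (x - z) * h x)
    _ ≤ ∫ x, ‖g (x - z)‖ * C := by
        refine integral_mono (integrable_smear_integrand hg h z).norm
          ((hg.comp_sub_right z).norm.mul_const C) fun x => ?_
        rw [norm_mul]
        gcongr
        exact hC x
    _ = _ := by rw [integral_mul_const, integral_sub_right_eq_self (fun x => ‖g x‖) z]

theorem smear_add_smul (hg : Integrable g) (h k : 𝓢(Space d, ℝ)) (s : ℝ) (z : Space d) :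
    smear g (h + s • k) z = smear g h z + s * smear g k z := by
  rw [smear, smear, smear, ← integral_const_mul, ← integral_add (integrable_smear_integrand hg h z)
    ((integrable_smear_integrand hg k z).const_mul s)]
  refine integral_congr_ae (Eventually.of_forall fun x => ?_)
  simp only [add_apply, smul_apply, smul_eq_mul]
  ring

theorem smear_zero (g : Space d → ℝ) (z : Space d) : smear g 0 z = 0 := by simp [smear]

theorem smear_smul (g : Space d → ℝ) (h : 𝓢(Space d, ℝ)) (s : ℝ) (z : Space d) :
    smear g (s • h) z = s * smear g h z := by
  rw [smear, smear, ← integral_const_mul]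
  refine integral_congr_ae (Eventually.of_forall fun x => ?_)
  simp only [smul_apply, smul_eq_mul]
  ring

/-- One factor is integrable and the others are bounded, so smeared propagators need nothing beyond
`g ∈ L¹`. -/
theorem integrable_prod_smear (hg : Integrable g) {ι : Type*} [DecidableEq ι]
    (h : ι → 𝓢(Space d, ℝ)) {A : Finset ι} (hA : A.Nonempty) :
    Integrable (fun z => ∏ j ∈ A, smear g (h j) z) := by
  induction A using Finset.induction with
  | empty => exact absurd hA Finset.not_nonempty_empty
  | insert k J hk ih =>
    simp only [Finset.prod_insert hk]
    rcases J.eq_empty_or_nonempty with rfl | hJ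
    · simpa using integrable_smear hg (h k)
    · obtain ⟨M, -, hM⟩ := exists_abs_smear_le hg (h k)
      exact (ih hJ).bdd_mul (continuous_smear hg (h k)).aestronglyMeasurable
        (Eventually.of_forall hM)

/-! ### Moments of the smeared field -/

theorem measurable_eval (h : 𝓢(Space d, ℝ)) : Measurable fun φ : Tempered d => φ h :=
  (PointwiseConvergenceCLM.evalCLM (RingHom.id ℝ) ℝ h).continuous.measurable

variable {ψ : ℝ → ℂ} {ν : Measure (Tempered d)}

/-- By the mean value inequality `‖ψ(u)‖ ≤ C |u|` near zero, so `ψ` of a small integrable function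
is integrable. -/
theorem integrable_comp_smear {δ C : ℝ} (hψc : Continuous ψ) (hψ0 : ψ 0 = 0)
    (hd : ∀ u, |u| < δ → HasDerivAt ψ (deriv ψ u) u) (hC : ∀ u, |u| < δ → ‖deriv ψ u‖ ≤ C)
    (hg : Integrable g) (h : 𝓢(Space d, ℝ)) (hh : ∀ z, |smear g h z| < δ) :
    Integrable (fun z => ψ (smear g h z)) := by
  refine ((integrable_smear hg h).norm.const_mul C).mono'
    (hψc.comp (continuous_smear hg h)).aestronglyMeasurable (Eventually.of_forall fun z => ?_)
  have h0 : (0 : ℝ) ∈ Set.Ioo (-δ) δ := by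
    have := (abs_nonneg _).trans_lt (hh z); constructor <;> linarith
  have := (convex_Ioo (-δ) δ).norm_image_sub_le_of_norm_hasDerivWithin_le (f := ψ)
    (f' := deriv ψ) (C := C) (x := 0) (y := smear g h z)
    (fun y hy => (hd y (abs_lt.2 hy)).hasDerivWithinAt) (fun y hy => hC y (abs_lt.2 hy)) h0
    (abs_lt.1 (hh z))
  simpa [hψ0] using this

theorem memLp_smeared_field [IsProbabilityMeasure ν] (hψc : Continuous ψ) (hψ0 : ψ 0 = 0)
    (hψs : ContDiffAt ℝ ∞ ψ 0) (hg : Integrable g) (hν : IsConvolutedLevyNoise ν ψ g)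
    (h : 𝓢(Space d, ℝ)) (p : ℕ) : MemLp (fun φ : Tempered d => φ h) p ν := by
  refine memLp_of_integrable_pow_even (measurable_eval h).aestronglyMeasurable (fun n => ?_) p
  have hψn : ∀ m : ℕ, ContDiffAt ℝ m ψ 0 := fun m => hψs.of_le (mod_cast le_top)
  -- The order beyond `2n` makes `κ (2 * n)` differentiable, hence continuous, so that `κ 0` is
  -- `C^{2n}`.
  obtain ⟨δ, hδ, C, hD, hB⟩ := exists_hasDerivAt_iteratedDeriv (hψn (2 * n + 1))
  obtain ⟨M, hM0, hM⟩ := exists_abs_smear_le hg h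
  set ε := δ / (M + 1) with hε
  have hε0 : 0 < ε := by positivity
  have hlt : ∀ s : ℝ, |s| < ε → ∃ b < δ, ∀ z, |s * smear g h z| ≤ b := by
    intro s hs
    rw [hε, lt_div_iff₀ (by linarith)] at hs
    refine ⟨|s| * M, by nlinarith [abs_nonneg s], fun z => ?_⟩
    rw [abs_mul]
    gcongr
    exact hM z
  set κ : ℕ → ℝ → ℂ := fun a s =>
    ∫ z, iteratedDeriv a ψ (s * smear g h z) * ((smear g h z) ^ a : ℝ) with hκ
  have hGm : AEMeasurable (smear g h) := (continuous_smear hg h).measurable.aemeasurable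
  have hpow : ∀ a : ℕ, Integrable (fun z => (smear g h z) ^ (a + 1)) := fun a => by
    have := integrable_prod_smear hg (ι := Fin (a + 1)) (fun _ => h) Finset.univ_nonempty
    simpa using this
  have hψint : ∀ s : ℝ, |s| < ε → Integrable (fun z => ψ (s * smear g h z)) := by
    intro s hs
    obtain ⟨b, hb, hsb⟩ := hlt s hs
    have := integrable_comp_smear hψc hψ0 (by simpa using hD 0 (by omega))
      (by simpa using hB 1 (by omega)) hg (s • h)
      (fun z => by rw [smear_smul]; exact (hsb z).trans_lt hb)
    simpa only [smear_smul] using this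
  have hκd : ∀ a < 2 * n + 1, ∀ s ∈ Set.Ioo (-ε) ε, HasDerivAt (κ a) (κ (a + 1) s) s := by
    intro a ha s hs
    obtain ⟨b, hb, hsb⟩ := hlt s (abs_lt.2 hs)
    have hint : Integrable (fun z => iteratedDeriv a ψ (s * smear g h z) *
        ((smear g h z) ^ a : ℝ)) := by
      cases a with
      -- For `a = 0` the weight is the constant `1`, so integrability has to come from `ψ 0 = 0`.
      | zero => simpa using hψint s (abs_lt.2 hs)
      | succ a =>
        exact integrable_comp_mul (hB (a + 1) (by omega)) (measurable_iteratedDeriv hψc _)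
          (hGm.const_mul s) (fun z => (hsb z).trans_lt hb) (hpow a)
    have key := hasDerivAt_integral_comp (μ := volume) (hD a ha) (hB (a + 1) (by omega))
      (measurable_iteratedDeriv hψc _) (measurable_iteratedDeriv hψc _) (hGm.const_mul s) hGm
      (hGm.pow_const a) hb hsb hM (by simpa only [pow_succ'] using hpow a) hint
    -- `key` is a derivative at zero in the increment; composing with `t ↦ t - s` moves it to `s`.
    have h2 : HasDerivAt (fun t : ℝ => t - s) 1 s := (hasDerivAt_id s).sub_const s
    have key0 := key
    rw [← sub_self s] at key0
    have key' := HasDerivAt.scomp (h := fun t => t - s) s key0 h2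
    simp only [one_smul] at key'
    refine (key'.congr_deriv ?_).congr_of_eventuallyEq (Eventually.of_forall fun t => ?_)
    · simp only [hκ, pow_succ' _ a]
    · simp only [hκ, Function.comp]
      refine integral_congr_ae (Eventually.of_forall fun z => ?_)
      simp only
      congr 2
      ring
  have hκc : ContDiffOn ℝ (2 * n : ℕ) (κ 0) (Set.Ioo (-ε) ε) :=
    contDiffOn_of_hasDerivAt isOpen_Ioo (fun k hk => hκd k (by omega))
      fun s hs => (hκd (2 * n) (by omega) s hs).continuousAt.continuousWithinAt
  have hexp : ContDiffAt ℝ (2 * n : ℕ) (fun s => Complex.exp (κ 0 s)) 0 :=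
    hκc.cexp.contDiffAt (Ioo_mem_nhds (by linarith) hε0)
  obtain ⟨δ', hδ', C', hD', hB'⟩ := exists_hasDerivAt_iteratedDeriv hexp
  refine integrable_pow_of_hasDerivAt_charFun (μ := ν) (X := fun φ : Tempered d => φ h)
    (measurable_eval h).aemeasurable
    (f := fun a => iteratedDeriv a fun s => Complex.exp (κ 0 s)) (lt_min hδ' hε0) ?_ ?_ ?_
    (C := C')
  · intro s hs
    have hs' := abs_lt.2 hs
    have := hν (s • h)
    rw [charFunctional] at this
    simp only [smear_smul, ← smear.eq_def, map_smul, smul_eq_mul] at this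
    simp only [iteratedDeriv_zero, hκ, pow_zero, Complex.ofReal_one, mul_one]
    exact this.symm
  · intro k hk s hs
    exact hD' k hk s ((abs_lt.2 hs).trans_le (min_le_left _ _))
  · intro s hs
    exact hB' _ le_rfl s ((abs_lt.2 hs).trans_le (min_le_left _ _))

/-- The moments of the smeared field `φ(h_j)`, and their cumulants `c_l ∫ ∏ G_j`. -/
theorem cumulantRecursion_smeared_field [IsProbabilityMeasure ν] (hψ : IsLevyCharacteristic ψ)
    (hψs : ContDiffAt ℝ ∞ ψ 0) (hg : Integrable g) (hν : IsConvolutedLevyNoise ν ψ g)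
    {ι : Type*} [Fintype ι] [DecidableEq ι] (h : ι → 𝓢(Space d, ℝ)) :
    CumulantRecursion (fun A => ∫ φ : Tempered d, ∏ j ∈ A, φ (h j) ∂ν)
      (fun A => levyCoeff ψ A.card * ∫ z, ∏ j ∈ A, smear g (h j) z) := by
  obtain ⟨δ, hδ, C, hD, hB⟩ := exists_hasDerivAt_iteratedDeriv (n := Fintype.card ι + 1)
    (hψs.of_le (mod_cast le_top))
  have hcard : ∀ {A : Finset ι} {j}, j ∉ A → A.card < Fintype.card ι := fun {A j} hj =>
    Finset.card_lt_univ_of_notMem hj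
  have hlp := memLp_smeared_field hψ.continuous hψ.map_zero hψs hg hν
  have hGm : ∀ k, AEMeasurable (smear g k) := fun k =>
    (continuous_smear hg k).measurable.aemeasurable
  -- The uniform gap between `b` and `δ` keeps `k + s • h j` in `U` for small `s`, as each smeared
  -- propagator is bounded.
  set U : Set 𝓢(Space d, ℝ) := {k | ∃ b < δ, ∀ z, |smear g k z| ≤ b} with hUdef
  set K : Finset ι → 𝓢(Space d, ℝ) → ℂ := fun A k =>
    ∫ z, iteratedDeriv A.card ψ (smear g k z) * (∏ j ∈ A, smear g (h j) z : ℝ) with hK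
  set Ψ : Finset ι → 𝓢(Space d, ℝ) → ℂ := fun A k =>
    ∫ φ : Tempered d, (∏ j ∈ A, (Complex.I * φ (h j))) * Complex.exp (Complex.I * (φ k : ℝ)) ∂ν
    with hΨ
  have hIprod : ∀ (A : Finset ι) (φ : Tempered d), ∏ j ∈ A, (Complex.I * φ (h j)) =
      Complex.I ^ A.card * (∏ j ∈ A, φ (h j) : ℝ) := fun A φ => by
    rw [Finset.prod_mul_distrib, Finset.prod_const]; push_cast; rfl
  have hprod : ∀ A : Finset ι, Integrable (fun φ : Tempered d => ∏ j ∈ A, φ (h j)) ν := fun A =>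
    (memLp_one_iff_integrable).1 (by exact_mod_cast memLp_prod_of_forall (fun j => hlp (h j)) A 1)
  have h0U : (0 : 𝓢(Space d, ℝ)) ∈ U := ⟨0, hδ, fun z => by simp [smear_zero]⟩
  have key := cumulantRecursion_of_hasDerivAt (U := U) (e := h) (Ψ := Ψ) (K := K)
    ?_ ?_ ?_ ?_ h0U
  -- At `k = 0` both families carry the factor `i^|A|`. Every term of the recursion then has the
  -- same power of `i`, which cancels.
  · have hΨ0 : ∀ A, Ψ A 0 = Complex.I ^ A.card * (∫ φ : Tempered d, ∏ j ∈ A, φ (h j) ∂ν : ℝ) := by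
      intro A
      simp only [hΨ, hIprod, map_zero, Complex.ofReal_zero, mul_zero, Complex.exp_zero, mul_one]
      rw [integral_const_mul, integral_complex_ofReal]
    have hK0 : ∀ A, K A 0 = Complex.I ^ A.card *
        (levyCoeff ψ A.card * ∫ z, ∏ j ∈ A, smear g (h j) z : ℝ) := by
      intro A
      simp only [hK, smear_zero, iteratedDeriv_eq_levyCoeff hψ.hermitian]
      rw [integral_const_mul, integral_complex_ofReal]
      push_cast
      ring
    intro k J hk
    have h1 := key k J hk
    simp only [hΨ0, hK0] at h1
    have h2 : ∀ A ∈ J.powerset, Complex.I ^ (insert k A).card *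
        ((levyCoeff ψ (insert k A).card * ∫ z, ∏ j ∈ insert k A, smear g (h j) z : ℝ) : ℂ) *
        (Complex.I ^ (J \ A).card * ((∫ φ : Tempered d, ∏ j ∈ J \ A, φ (h j) ∂ν : ℝ) : ℂ)) =
        Complex.I ^ (insert k J).card *
        (((levyCoeff ψ (insert k A).card * ∫ z, ∏ j ∈ insert k A, smear g (h j) z) *
          ∫ φ : Tempered d, ∏ j ∈ J \ A, φ (h j) ∂ν : ℝ) : ℂ) := by
      intro A hA
      rw [Finset.mem_powerset] at hA
      have : (insert k J).card = (insert k A).card + (J \ A).card := by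
        rw [Finset.card_insert_of_notMem hk, Finset.card_insert_of_notMem fun h => hk (hA h)]
        have := Finset.card_sdiff_add_card_eq_card hA
        omega
      rw [this, pow_add]
      push_cast
      ring
    rw [Finset.sum_congr rfl h2, ← Finset.mul_sum, ← Complex.ofReal_sum] at h1
    exact_mod_cast mul_left_cancel₀ (pow_ne_zero _ Complex.I_ne_zero) h1
  · rintro k ⟨b, hb, hk⟩ j
    obtain ⟨M, hM0, hM⟩ := exists_abs_smear_le hg (h j)
    have hlim : Tendsto (fun s : ℝ => b + |s| * M) (𝓝 0) (𝓝 b) := by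
      have : Continuous fun s : ℝ => b + |s| * M := by fun_prop
      simpa using this.tendsto 0
    filter_upwards [hlim.eventually_lt_const hb] with s hs
    refine ⟨_, hs, fun z => ?_⟩
    rw [smear_add_smul hg]
    calc _ ≤ |smear g k z| + |s| * |smear g (h j) z| := by
          rw [← abs_mul]; exact abs_add_le _ _
      _ ≤ b + |s| * M := by gcongr; exacts [hk z, hM z]
  · rintro A j hj k ⟨b, hb, hk⟩
    obtain ⟨M, hM0, hM⟩ := exists_abs_smear_le hg (h j)
    have hlt : ∀ z, |smear g k z| < δ := fun z => (hk z).trans_lt hb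
    have hA := hcard hj
    have hint : Integrable (fun z => iteratedDeriv A.card ψ (smear g k z) *
        (∏ j ∈ A, smear g (h j) z : ℝ)) := by
      rcases A.eq_empty_or_nonempty with rfl | hne
      · simpa using integrable_comp_smear hψ.continuous hψ.map_zero
          (by simpa using hD 0 (by omega)) (by simpa using hB 1 (by omega)) hg k hlt
      · exact integrable_comp_mul (hB A.card (by omega)) (measurable_iteratedDeriv hψ.continuous _)
          (hGm k) hlt (integrable_prod_smear hg h hne)
    have := hasDerivAt_integral_comp (μ := volume) (hD A.card (by omega))
      (hB (A.card + 1) (by omega))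
      (measurable_iteratedDeriv hψ.continuous _) (measurable_iteratedDeriv hψ.continuous _)
      (hGm k) (hGm (h j)) (Finset.aemeasurable_fun_prod A fun i _ => hGm (h i)) hb hk hM
      (by simpa only [Finset.prod_insert hj] using
        integrable_prod_smear hg h (Finset.insert_nonempty j A)) hint
    simp only [hK, smear_add_smul hg, Finset.prod_insert hj, Finset.card_insert_of_notMem hj]
    exact this
  · intro A j hj k _
    have h1 : Integrable (fun φ : Tempered d => ∏ j ∈ A, (Complex.I * φ (h j))) ν := by
      simp only [hIprod]
      exact (hprod A).ofReal.const_mul _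
    have h2 : Integrable (fun φ : Tempered d =>
        (φ (h j) : ℂ) * ∏ j ∈ A, (Complex.I * φ (h j))) ν := by
      have : Integrable (fun φ : Tempered d =>
          Complex.I ^ A.card * ((∏ j ∈ insert j A, φ (h j) : ℝ) : ℂ)) ν :=
        (hprod (insert j A)).ofReal.const_mul _
      refine this.congr (Eventually.of_forall fun φ => ?_)
      simp only [hIprod, Finset.prod_insert hj]
      push_cast
      ring
    have := hasDerivAt_integral_mul_exp (measurable_eval (h j)).aemeasurable
      (measurable_eval k).aemeasurable h1 h2
    simp only [hΨ, Finset.prod_insert hj, map_add, map_smul, smul_eq_mul]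
    exact this
  · intro k _
    have := hν k
    rw [charFunctional] at this
    simp only [hΨ, hK, Finset.prod_empty, one_mul, Finset.card_empty, iteratedDeriv_zero,
      Complex.ofReal_one, mul_one]
    exact this

end LevyFeynman

namespace LevyFeynman

open Filter Topology

/-! ### Products and convergence in `L^p` -/

section Holder

variable {E : Type*} [MeasurableSpace E] {μ : Measure E} {ι : Type*}

theorem eLpNorm_natCast_eq {f : E → ℝ} {l : ℕ} (hl : 1 ≤ l) :
    eLpNorm f (l : ℝ≥0∞) μ = (∫⁻ z, ‖f z‖ₑ ^ l ∂μ) ^ (1 / (l : ℝ)) := by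
  rw [eLpNorm_eq_lintegral_rpow_enorm_toReal (by simp; omega) (ENNReal.natCast_ne_top l)]
  simp only [ENNReal.toReal_natCast, ENNReal.rpow_natCast]

/-- Generalized Hölder inequality for `|A|` factors, all with exponent `|A|`. -/
theorem lintegral_enorm_prod_le {A : Finset ι} (hA : A.Nonempty) {f : ι → E → ℝ}
    (hf : ∀ j ∈ A, AEStronglyMeasurable (f j) μ) :
    ∫⁻ z, ‖∏ j ∈ A, f j z‖ₑ ∂μ ≤ ∏ j ∈ A, eLpNorm (f j) (A.card : ℝ≥0∞) μ := by
  have hc : (A.card : ℝ) ≠ 0 := by exact_mod_cast hA.card_pos.ne'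
  have key := ENNReal.lintegral_prod_norm_pow_le (μ := μ) A
    (f := fun j z => ‖f j z‖ₑ ^ A.card) (p := fun _ => 1 / (A.card : ℝ))
    (fun j hj => (hf j hj).enorm.pow_const _) (by simp [hc]) (fun _ _ => by positivity)
  calc ∫⁻ z, ‖∏ j ∈ A, f j z‖ₑ ∂μ
      = ∫⁻ z, ∏ j ∈ A, (‖f j z‖ₑ ^ A.card) ^ (1 / (A.card : ℝ)) ∂μ := by
        refine lintegral_congr fun z => ?_
        have : ‖∏ j ∈ A, f j z‖ₑ = ∏ j ∈ A, ‖f j z‖ₑ := by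
          simp only [← ofReal_norm, norm_prod]
          rw [ENNReal.ofReal_prod_of_nonneg fun _ _ => norm_nonneg _]
        rw [this]
        refine Finset.prod_congr rfl fun j _ => ?_
        rw [← ENNReal.rpow_natCast, ← ENNReal.rpow_mul, mul_one_div_cancel hc, ENNReal.rpow_one]
    _ ≤ _ := key
    _ = _ := Finset.prod_congr rfl fun j _ => (eLpNorm_natCast_eq hA.card_pos).symm

theorem integrable_prod_of_memLp {A : Finset ι} (hA : A.Nonempty) {f : ι → E → ℝ}
    (hf : ∀ j ∈ A, MemLp (f j) (A.card : ℝ≥0∞) μ) : Integrable (fun z => ∏ j ∈ A, f j z) μ :=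
  ⟨Finset.aestronglyMeasurable_fun_prod A fun j hj => (hf j hj).1,
    (lintegral_enorm_prod_le hA fun j hj => (hf j hj).1).trans_lt
      (ENNReal.prod_lt_top fun j hj => (hf j hj).2)⟩

/-- Convergence of the factors in `L^l` implies convergence of the integral of the product of `l`
factors. -/
theorem tendsto_integral_prod {A : Finset ι} (hA : A.Nonempty) {F : ℕ → ι → E → ℝ}
    {f : ι → E → ℝ} (hf : ∀ j ∈ A, MemLp (f j) (A.card : ℝ≥0∞) μ)
    (hF : ∀ n, ∀ j ∈ A, MemLp (fun z => F n j z - f j z) (A.card : ℝ≥0∞) μ)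
    (hlim : ∀ j ∈ A, Tendsto (fun n => eLpNorm (fun z => F n j z - f j z) (A.card : ℝ≥0∞) μ)
      atTop (𝓝 0)) :
    Tendsto (fun n => ∫ z, ∏ j ∈ A, F n j z ∂μ) atTop (𝓝 (∫ z, ∏ j ∈ A, f j z ∂μ)) := by
  classical
  set H : ℕ → Finset ι → ι → E → ℝ := fun n t j =>
    if j ∈ t then fun z => F n j z - f j z else f j with hH
  have hHmem : ∀ n t, ∀ j ∈ A, MemLp (H n t j) (A.card : ℝ≥0∞) μ := by
    intro n t j hj
    simp only [hH]
    split_ifs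
    exacts [hF n j hj, hf j hj]
  have hexp : ∀ n z, ∏ j ∈ A, F n j z = ∑ t ∈ A.powerset, ∏ j ∈ A, H n t j z := by
    intro n z
    calc ∏ j ∈ A, F n j z = ∏ j ∈ A, ((F n j z - f j z) + f j z) := by simp
      _ = _ := by
        rw [Finset.prod_add]
        refine Finset.sum_congr rfl fun t ht => ?_
        rw [← Finset.prod_sdiff (Finset.mem_powerset.1 ht), mul_comm]
        congr 1
        · exact Finset.prod_congr rfl fun j hj => by
            simp only [hH, if_neg (Finset.mem_sdiff.1 hj).2]
        · exact Finset.prod_congr rfl fun j hj => by simp only [hH, if_pos hj]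
  -- In the expansion of `∏ ((F - f) + f)`, a term with at least one factor `F - f` vanishes in the
  -- limit by Hölder; only `t = ∅` survives.
  have hterm : ∀ t ∈ A.powerset, Tendsto (fun n => ∫ z, ∏ j ∈ A, H n t j z ∂μ) atTop
      (𝓝 (if t = ∅ then ∫ z, ∏ j ∈ A, f j z ∂μ else 0)) := by
    intro t ht
    rcases t.eq_empty_or_nonempty with rfl | ⟨k, hk⟩
    · simp [hH]
    · rw [if_neg (Finset.ne_empty_of_mem hk)]
      have hkA : k ∈ A := Finset.mem_powerset.1 ht hk
      have h1 : Tendsto (fun n => ∏ j ∈ A, eLpNorm (H n t j) (A.card : ℝ≥0∞) μ) atTop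
          (𝓝 (∏ j ∈ A, if j ∈ t then 0 else eLpNorm (f j) (A.card : ℝ≥0∞) μ)) := by
        refine ENNReal.tendsto_finsetProd_of_ne_top A (fun j hj => ?_) (fun j hj => ?_)
        · simp only [hH]
          split_ifs
          exacts [hlim j hj, tendsto_const_nhds]
        · split_ifs
          exacts [ENNReal.zero_ne_top, (hf j hj).2.ne]
      have h0 : ∏ j ∈ A, (if j ∈ t then 0 else eLpNorm (f j) (A.card : ℝ≥0∞) μ) = 0 :=
        Finset.prod_eq_zero hkA (by simp [hk])
      rw [h0] at h1
      rw [tendsto_zero_iff_enorm_tendsto_zero]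
      refine tendsto_of_tendsto_of_tendsto_of_le_of_le tendsto_const_nhds h1
        (fun _ => zero_le) fun n => ?_
      exact (enorm_integral_le_lintegral_enorm _).trans
        (lintegral_enorm_prod_le hA fun j hj => (hHmem n t j hj).1)
  have hsum := tendsto_finsetSum A.powerset hterm
  rw [Finset.sum_ite_eq' A.powerset ∅ fun _ => ∫ z, ∏ j ∈ A, f j z ∂μ,
    if_pos (Finset.empty_mem_powerset A)] at hsum
  refine hsum.congr fun n => ?_
  rw [← integral_finsetSum _ fun t _ => integrable_prod_of_memLp hA (hHmem n t)]
  exact integral_congr_ae (Eventually.of_forall fun z => (hexp n z).symm)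

/-- A sequence that is bounded in `L²` and converges almost everywhere converges in `L¹`. -/
theorem integrable_and_tendsto_of_integral_sq_le [IsFiniteMeasure μ] {Y : ℕ → E → ℝ} {Z : E → ℝ}
    {C : ℝ} (hY : ∀ n, AEStronglyMeasurable (Y n) μ) (hY2 : ∀ n, Integrable (fun x => Y n x ^ 2) μ)
    (hC : ∀ n, ∫ x, Y n x ^ 2 ∂μ ≤ C) (hlim : ∀ᵐ x ∂μ, Tendsto (fun n => Y n x) atTop (𝓝 (Z x))) :
    Integrable Z μ ∧ Tendsto (fun n => ∫ x, Y n x ∂μ) atTop (𝓝 (∫ x, Z x ∂μ)) := by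
  have hui : UniformIntegrable Y 1 μ := by
    refine uniformIntegrable_of le_rfl ENNReal.one_ne_top hY fun ε hε => ?_
    have hCε : 0 ≤ C / ε := by
      have : 0 ≤ C := (integral_nonneg fun x => sq_nonneg _).trans (hC 0)
      positivity
    -- Where `|Y| ≥ K`, `|Y| ≤ Y² / K`, so the tail integral is at most `C / K`; `K = C / ε + 1` is
    -- positive and makes this at most `ε`.
    refine ⟨(C / ε + 1).toNNReal, fun n => ?_⟩
    rw [eLpNorm_one_eq_lintegral_enorm]
    have hK : (0 : ℝ) < C / ε + 1 := by positivity
    calc _ ≤ ∫⁻ x, ENNReal.ofReal (Y n x ^ 2 / (C / ε + 1)) ∂μ := by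
          refine lintegral_mono fun x => ?_
          by_cases hx : x ∈ {x | (C / ε + 1).toNNReal ≤ ‖Y n x‖₊}
          · rw [Set.indicator_of_mem hx, ← ofReal_norm]
            refine ENNReal.ofReal_le_ofReal ?_
            have hx' : C / ε + 1 ≤ ‖Y n x‖ := by
              rw [← Real.coe_toNNReal _ hK.le]; exact hx
            rw [le_div_iff₀ hK, ← sq_abs, ← Real.norm_eq_abs, sq]
            gcongr
          · rw [Set.indicator_of_notMem hx]; simp
      _ = ENNReal.ofReal (∫ x, Y n x ^ 2 / (C / ε + 1) ∂μ) :=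
          (ofReal_integral_eq_lintegral_ofReal ((hY2 n).div_const _)
            (Eventually.of_forall fun x => by positivity)).symm
      _ ≤ ENNReal.ofReal ε := by
          refine ENNReal.ofReal_le_ofReal ?_
          rw [integral_div, div_le_iff₀ hK]
          refine (hC n).trans ?_
          have : ε * (C / ε) = C := by field_simp
          linarith
  have hZ := hui.memLp_of_ae_tendsto hlim
  refine ⟨memLp_one_iff_integrable.1 hZ, ?_⟩
  have h1 := tendsto_Lp_finite_of_tendsto_ae le_rfl ENNReal.one_ne_top hY hZ
    hui.unifIntegrable hlim
  exact tendsto_integral_of_L1' _ (memLp_one_iff_integrable.1 hZ).aestronglyMeasurable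
    (Eventually.of_forall fun n => memLp_one_iff_integrable.1 (hui.memLp n)) h1

end Holder

/-! ### Mollification -/

variable {d : ℕ} {g : Space d → ℝ}

/-- Translation acts continuously on `L^l` for finite `l`. -/
theorem tendsto_lintegral_translate_sub {l : ℕ} (hl : 1 ≤ l) (hg : MemLp g (l : ℝ≥0∞)) :
    Tendsto (fun u : Space d => ∫⁻ z, ‖g (z - u) - g z‖ₑ ^ l) (𝓝 0) (𝓝 0) := by
  have : Fact (1 ≤ (l : ℝ≥0∞)) := ⟨by exact_mod_cast hl⟩
  let τ : Space d → C(Space d, Space d) := fun u => ⟨fun z => z - u, by fun_prop⟩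
  have hτ : Continuous τ := by
    refine ContinuousMap.continuous_of_continuous_uncurry _ ?_
    change Continuous fun p : Space d × Space d => p.2 - p.1
    fun_prop
  have hτm : ∀ u, MeasurePreserving (τ u) := fun u => measurePreserving_sub_right volume u
  have h1 : Continuous fun u => Lp.compMeasurePreserving (τ u) (hτm u) (hg.toLp g) :=
    continuous_const.compMeasurePreservingLp hτ hτm (ENNReal.natCast_ne_top l)
  have h2 := (h1.tendsto 0)
  rw [tendsto_iff_edist_tendsto_0] at h2
  have h3 : ∀ u, edist (Lp.compMeasurePreserving (τ u) (hτm u) (hg.toLp g))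
      (Lp.compMeasurePreserving (τ 0) (hτm 0) (hg.toLp g)) ^ l
      = ∫⁻ z, ‖g (z - u) - g z‖ₑ ^ l := by
    intro u
    rw [Lp.toLp_compMeasurePreserving, Lp.toLp_compMeasurePreserving, Lp.edist_toLp_toLp,
      eLpNorm_natCast_eq hl, ← ENNReal.rpow_natCast, ← ENNReal.rpow_mul,
      one_div_mul_cancel (by positivity), ENNReal.rpow_one]
    simp [τ]
  have h4 := ((ENNReal.continuous_pow l).tendsto 0).comp h2
  rw [zero_pow (by omega)] at h4
  exact h4.congr h3

/-- Jensen's inequality for the probability measure `P`, then Tonelli: an average of translates is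
no farther from `g` in `L^l` than the translates are. -/
theorem lintegral_enorm_integral_sub_pow_le {P : Measure (Space d)} [IsProbabilityMeasure P]
    {l : ℕ} (hl : 1 ≤ l) (hg : AEStronglyMeasurable g)
    (hint : ∀ z, Integrable (fun u => g (z - u)) P) {ε : ℝ≥0∞}
    (hε : ∀ᵐ u ∂P, ∫⁻ z, ‖g (z - u) - g z‖ₑ ^ l ≤ ε) :
    ∫⁻ z, ‖(∫ u, g (z - u) ∂P) - g z‖ₑ ^ l ≤ ε := by
  have hmeas : AEMeasurable (fun p : Space d × Space d => ‖g (p.1 - p.2) - g p.1‖ₑ ^ l)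
      (volume.prod P) := by
    refine AEMeasurable.pow_const (AEStronglyMeasurable.enorm ?_) l
    exact (hg.comp_quasiMeasurePreserving
      (quasiMeasurePreserving_sub_of_right_invariant volume P)).sub
      (hg.comp_quasiMeasurePreserving Measure.quasiMeasurePreserving_fst)
  calc ∫⁻ z, ‖(∫ u, g (z - u) ∂P) - g z‖ₑ ^ l
      ≤ ∫⁻ z, ∫⁻ u, ‖g (z - u) - g z‖ₑ ^ l ∂P := by
        refine lintegral_mono fun z => ?_
        have hd : AEStronglyMeasurable (fun u => g (z - u) - g z) P :=
          (hint z).aestronglyMeasurable.sub aestronglyMeasurable_const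
        have h1 : (∫ u, g (z - u) ∂P) - g z = ∫ u, (g (z - u) - g z) ∂P := by
          rw [integral_sub (hint z) (integrable_const _)]
          simp
        have h2 := eLpNorm'_le_eLpNorm'_of_exponent_le (μ := P) (p := 1) (q := l) one_pos
          (by exact_mod_cast hl) hd
        simp only [eLpNorm'_eq_lintegral_enorm, ENNReal.rpow_one, ENNReal.rpow_natCast,
          div_one] at h2
        dsimp only
        rw [h1]
        calc _ ≤ (∫⁻ u, ‖g (z - u) - g z‖ₑ ∂P) ^ l := by
              gcongr; exact enorm_integral_le_lintegral_enorm _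
          _ ≤ ((∫⁻ u, ‖g (z - u) - g z‖ₑ ^ l ∂P) ^ (1 / (l : ℝ))) ^ l := by gcongr
          _ = _ := by
              rw [← ENNReal.rpow_natCast, ← ENNReal.rpow_mul,
                one_div_mul_cancel (by positivity), ENNReal.rpow_one]
    _ = ∫⁻ u, (∫⁻ z, ‖g (z - u) - g z‖ₑ ^ l) ∂P := lintegral_lintegral_swap hmeas
    _ ≤ ∫⁻ _, ε ∂P := lintegral_mono_ae hε
    _ = ε := by simp

/-- A sequence of bump functions shrinking to the origin. -/
noncomputable def bump (d n : ℕ) : ContDiffBump (0 : Space d) where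
  rIn := 1 / (n + 1) / 2
  rOut := 1 / (n + 1)
  rIn_pos := by positivity
  rIn_lt_rOut := half_lt_self (by positivity)

theorem tendsto_bump_rOut (d : ℕ) : Tendsto (fun n => (bump d n).rOut) atTop (𝓝 0) :=
  tendsto_one_div_add_atTop_nhds_zero_nat

/-- A sequence of Schwartz functions approximating the delta distribution at `x`. -/
noncomputable def mollifier (n : ℕ) (x : Space d) : 𝓢(Space d, ℝ) :=
  ((bump d n).hasCompactSupport_normed (μ := volume)).comp_homeomorph
    (Homeomorph.subRight x) |>.toSchwartzMap
    ((bump d n).contDiff_normed.comp (contDiff_id.sub contDiff_const))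

theorem mollifier_apply (n : ℕ) (x y : Space d) :
    mollifier n x y = (bump d n).normed volume (y - x) := rfl

theorem hasCompactSupport_mollifier (n : ℕ) (x : Space d) :
    HasCompactSupport (mollifier n x : Space d → ℝ) :=
  ((bump d n).hasCompactSupport_normed (μ := volume)).comp_homeomorph (Homeomorph.subRight x)

theorem IsGivenBy.tendsto_mollifier {φ : Tempered d} {f : Space d → ℝ} (hf : IsGivenBy φ f)
    (x : Space d) : Tendsto (fun n => φ (mollifier n x)) atTop (𝓝 (f x)) := by
  have := ContDiffBump.convolution_tendsto_right_of_continuous (μ := volume)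
    (tendsto_bump_rOut d) hf.1 x
  refine this.congr fun n => ?_
  rw [hf.2 _ (hasCompactSupport_mollifier n x), convolution_eq_swap]
  refine integral_congr_ae (Eventually.of_forall fun y => ?_)
  simp only [ContinuousLinearMap.lsmul_apply, smul_eq_mul, mollifier_apply]
  rw [← neg_sub y x, ContDiffBump.normed_neg, mul_comm]

/-- The probability measure with a bump function as density. -/
noncomputable def bumpMeasure (d n : ℕ) : Measure (Space d) :=
  volume.withDensity fun u => ENNReal.ofReal ((bump d n).normed volume u)

instance (n : ℕ) : IsProbabilityMeasure (bumpMeasure d n) := by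
  constructor
  rw [bumpMeasure, withDensity_apply _ MeasurableSet.univ, Measure.restrict_univ,
    ← ofReal_integral_eq_lintegral_ofReal (bump d n).integrable_normed
      (Eventually.of_forall (bump d n).nonneg_normed), (bump d n).integral_normed,
    ENNReal.ofReal_one]

theorem ae_bumpMeasure_norm_lt (d n : ℕ) : ∀ᵐ u ∂bumpMeasure d n, ‖u‖ < (bump d n).rOut := by
  rw [bumpMeasure, ae_withDensity_iff (by
    exact ((bump d n).continuous_normed.measurable).ennreal_ofReal)]
  refine Eventually.of_forall fun u hu => ?_
  have : u ∈ Function.support ((bump d n).normed volume) := by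
    rw [Function.mem_support]
    rintro h
    exact hu (by rw [h, ENNReal.ofReal_zero])
  rw [(bump d n).support_normed_eq] at this
  simpa using this

theorem integrable_bumpMeasure (hg : Integrable g) (n : ℕ) (z : Space d) :
    Integrable (fun u => g (z - u)) (bumpMeasure d n) := by
  have h := (hg.comp_sub_left z)
  obtain ⟨C, hC⟩ := exists_norm_le (mollifier n (0 : Space d))
  rw [bumpMeasure, integrable_withDensity_iff_integrable_smul₀'
    ((bump d n).continuous_normed.measurable.ennreal_ofReal.aemeasurable)
    (Eventually.of_forall fun _ => ENNReal.ofReal_lt_top)]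
  refine Integrable.bdd_mul (c := C) h ?_ (Eventually.of_forall fun u => ?_)
  · exact ((bump d n).continuous_normed.measurable.ennreal_ofReal.ennreal_toReal).aestronglyMeasurable
  · rw [ENNReal.toReal_ofReal ((bump d n).nonneg_normed u)]
    simpa [mollifier_apply] using hC u

/-- Reflecting at `x` and using that the bump is even turns mollification into an average of
translates of `g`. -/
theorem smear_mollifier (n : ℕ) (x z : Space d) :
    smear g (mollifier n x) z = ∫ u, g (x - z - u) ∂bumpMeasure d n := by
  rw [bumpMeasure, integral_withDensity_eq_integral_toReal_smul₀
    ((bump d n).continuous_normed.measurable.ennreal_ofReal.aemeasurable)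
    (Eventually.of_forall fun _ => ENNReal.ofReal_lt_top), smear,
    ← integral_sub_left_eq_self _ volume x]
  refine integral_congr_ae (Eventually.of_forall fun u => ?_)
  simp only [mollifier_apply, smul_eq_mul]
  rw [ENNReal.toReal_ofReal ((bump d n).nonneg_normed u), sub_sub_cancel_left,
    ContDiffBump.normed_neg, mul_comm, sub_right_comm]

theorem tendsto_eLpNorm_smear_mollifier {l : ℕ} (hl : 1 ≤ l) (hg : Integrable g)
    (hgl : MemLp g (l : ℝ≥0∞)) (x : Space d) :
    Tendsto (fun n => eLpNorm (fun z => smear g (mollifier n x) z - g (x - z)) (l : ℝ≥0∞))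
      atTop (𝓝 0) := by
  have h1 : ∀ n, ∫⁻ z, ‖smear g (mollifier n x) z - g (x - z)‖ₑ ^ l =
      ∫⁻ z, ‖(∫ u, g (z - u) ∂bumpMeasure d n) - g z‖ₑ ^ l := by
    intro n
    simp only [smear_mollifier]
    exact lintegral_sub_left_eq_self
      (fun w => ‖(∫ u, g (w - u) ∂bumpMeasure d n) - g w‖ₑ ^ l) x
  have h2 : Tendsto (fun n => ∫⁻ z, ‖smear g (mollifier n x) z - g (x - z)‖ₑ ^ l)
      atTop (𝓝 0) := by
    rw [ENNReal.tendsto_nhds_zero]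
    intro ε hε
    have h3 := (ENNReal.tendsto_nhds_zero.1 (tendsto_lintegral_translate_sub hl hgl)) ε hε
    obtain ⟨r, hr, hball⟩ := Metric.eventually_nhds_iff.1 h3
    filter_upwards [(tendsto_bump_rOut d).eventually_lt_const hr] with n hn
    rw [h1]
    refine lintegral_enorm_integral_sub_pow_le (P := bumpMeasure d n) hl hg.aestronglyMeasurable
      (integrable_bumpMeasure hg n) ?_
    filter_upwards [ae_bumpMeasure_norm_lt d n] with u hu
    exact hball (by rw [dist_zero_right]; exact hu.trans hn)
  have h4 := (ENNReal.continuous_rpow_const (y := 1 / (l : ℝ))).tendsto 0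
  rw [ENNReal.zero_rpow_of_pos (by positivity)] at h4
  refine (h4.comp h2).congr fun n => ?_
  rw [eLpNorm_natCast_eq hl]
  rfl

theorem memLp_comp_sub_left {p : ℝ≥0∞} (hg : MemLp g p) (x : Space d) :
    MemLp (fun z => g (x - z)) p :=
  hg.comp_measurePreserving (volume.measurePreserving_sub_left x)

theorem memLp_smear (hg : Integrable g) (h : 𝓢(Space d, ℝ)) {l : ℕ} (hl : 1 ≤ l) :
    MemLp (smear g h) (l : ℝ≥0∞) := by
  have hm := (continuous_smear hg h).aestronglyMeasurable (μ := (volume : Measure (Space d)))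
  rw [← integrable_norm_rpow_iff hm (by simp; omega) (ENNReal.natCast_ne_top l)]
  have : NeZero l := ⟨by omega⟩
  have := integrable_prod_smear hg (ι := Fin l) (fun _ => h) Finset.univ_nonempty
  refine this.norm.congr (Eventually.of_forall fun z => ?_)
  simp

/-- The cumulants of the mollified field converge. -/
theorem tendsto_cumulant_mollifier {ψ : ℝ → ℂ} (hg : Integrable g)
    (hg_pow : ∀ l : ℕ, 1 ≤ l → levyCoeff ψ l ≠ 0 → MemLp g (l : ℝ≥0∞)) {ι : Type*}
    (x : ι → Space d) {A : Finset ι} (hA : A.Nonempty) :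
    Tendsto (fun n => levyCoeff ψ A.card * ∫ z, ∏ j ∈ A, smear g (mollifier n (x j)) z) atTop
      (𝓝 (levyCoeff ψ A.card * ∫ z, ∏ j ∈ A, g (x j - z))) := by
  -- If the coefficient vanishes, `g` need not lie in this `L^l`, but both sides are zero.
  by_cases hc : levyCoeff ψ A.card = 0
  · simp [hc]
  · have hgl := hg_pow _ hA.card_pos hc
    refine Tendsto.const_mul _ (tendsto_integral_prod hA
      (F := fun n j => smear g (mollifier n (x j))) (f := fun j z => g (x j - z))
      (fun j _ => memLp_comp_sub_left hgl _)
      (fun n j _ => (memLp_smear hg _ hA.card_pos).sub (memLp_comp_sub_left hgl _))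
      fun j _ => tendsto_eLpNorm_smear_mollifier hA.card_pos hg hgl (x j))

/-! ### Moments of the field at points -/

theorem tendsto_fieldAt {φ : Tempered d} (h : ∃ f, IsGivenBy φ f) (x : Space d) :
    Tendsto (fun n => φ (mollifier n x)) atTop (𝓝 (fieldAt φ x)) := by
  rw [fieldAt, dif_pos h]
  exact h.choose_spec.tendsto_mollifier x

section Moments

variable {ψ : ℝ → ℂ} {ν : Measure (Tempered d)} {ι : Type*} [Fintype ι] [DecidableEq ι]

/-- The recursion writes a moment through cumulants, bounded because they converge, and moments over
strictly smaller sets. -/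
theorem exists_abs_moment_mollifier_le [IsProbabilityMeasure ν] (hψ : IsLevyCharacteristic ψ)
    (hψs : ContDiffAt ℝ ∞ ψ 0) (hg : Integrable g)
    (hg_pow : ∀ l : ℕ, 1 ≤ l → levyCoeff ψ l ≠ 0 → MemLp g (l : ℝ≥0∞))
    (hν : IsConvolutedLevyNoise ν ψ g) (x : ι → Space d) (J : Finset ι) :
    ∃ C, ∀ n, |∫ φ : Tempered d, ∏ j ∈ J, φ (mollifier n (x j)) ∂ν| ≤ C := by
  induction J using Finset.strongInduction with
  | H J ih =>
    rcases J.eq_empty_or_nonempty with rfl | ⟨k, hk⟩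
    · exact ⟨1, fun n => by simp⟩
    · obtain ⟨J', hkJ', rfl⟩ : ∃ J', k ∉ J' ∧ insert k J' = J :=
        ⟨J.erase k, Finset.notMem_erase k J, Finset.insert_erase hk⟩
      have hlt : ∀ A, J' \ A ⊂ insert k J' := fun A =>
        lt_of_le_of_lt Finset.sdiff_subset (Finset.ssubset_insert hkJ')
      choose C hC using fun A => ih _ (hlt A)
      have hT : ∀ A, ∃ B, ∀ n, |levyCoeff ψ (insert k A).card *
          ∫ z, ∏ j ∈ insert k A, smear g (mollifier n (x j)) z| ≤ B := by
        intro A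
        obtain ⟨B, hB⟩ := (tendsto_cumulant_mollifier hg hg_pow x
          (Finset.insert_nonempty k A)).abs.bddAbove_range
        exact ⟨B, fun n => hB ⟨n, rfl⟩⟩
      choose B hB using hT
      refine ⟨∑ A ∈ J'.powerset, B A * C A, fun n => ?_⟩
      have h1 := cumulantRecursion_smeared_field hψ hψs hg hν (fun j => mollifier n (x j)) k J' hkJ'
      dsimp only at h1
      rw [h1]
      refine (Finset.abs_sum_le_sum_abs _ _).trans (Finset.sum_le_sum fun A _ => ?_)
      rw [abs_mul]
      exact mul_le_mul (hB A n) (hC A n) (abs_nonneg _) ((abs_nonneg _).trans (hB A n))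

/-- The moments of the field at points exist and are limits of the moments of the mollified
field. -/
theorem integrable_and_tendsto_moment [IsProbabilityMeasure ν] (hψ : IsLevyCharacteristic ψ)
    (hψs : ContDiffAt ℝ ∞ ψ 0) (hg : Integrable g)
    (hg_pow : ∀ l : ℕ, 1 ≤ l → levyCoeff ψ l ≠ 0 → MemLp g (l : ℝ≥0∞))
    (hν : IsConvolutedLevyNoise ν ψ g) (hν_cont : SupportedOnContinuous ν)
    (x : ι → Space d) (J : Finset ι) :
    Integrable (fun φ => ∏ j ∈ J, fieldAt φ (x j)) ν ∧
      Tendsto (fun n => ∫ φ : Tempered d, ∏ j ∈ J, φ (mollifier n (x j)) ∂ν) atTop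
        (𝓝 (moment ν x J)) := by
  have hlp := memLp_smeared_field hψ.continuous hψ.map_zero hψs hg hν
  have hprod : ∀ n, ∀ p : ℕ, MemLp (fun φ : Tempered d => ∏ j ∈ J, φ (mollifier n (x j))) p ν :=
    fun n p => memLp_prod_of_forall (fun j => hlp _) J p
  -- The square of a product over `J` is the product over two disjoint copies of `J`, so its
  -- integral is again a mollified moment.
  obtain ⟨C, hC⟩ := exists_abs_moment_mollifier_le hψ hψs hg hg_pow hν (Sum.elim x x)
    (J.disjSum J)
  refine integrable_and_tendsto_of_integral_sq_le (C := C) (fun n => (hprod n 0).1)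
    (fun n => ?_) (fun n => ?_) ?_
  · have := hprod n 2
    exact MemLp.integrable_sq (by exact_mod_cast this)
  · refine le_trans (le_of_eq ?_) ((le_abs_self _).trans (hC n))
    refine integral_congr_ae (Eventually.of_forall fun φ => ?_)
    simp [Finset.prod_disjSum, sq]
  · filter_upwards [hν_cont] with φ hφ
    exact tendsto_finsetProd J fun j _ => tendsto_fieldAt hφ (x j)

/-- The truncated moments of the field at points. -/
theorem truncatedMoment_eq [IsProbabilityMeasure ν] (hψ : IsLevyCharacteristic ψ)
    (hψs : ContDiffAt ℝ ∞ ψ 0) (hg : Integrable g)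
    (hg_pow : ∀ l : ℕ, 1 ≤ l → levyCoeff ψ l ≠ 0 → MemLp g (l : ℝ≥0∞))
    (hν : IsConvolutedLevyNoise ν ψ g) (hν_cont : SupportedOnContinuous ν)
    (x : ι → Space d) {J : Finset ι} (hJ : J.Nonempty) :
    truncatedMoment ν x J = levyCoeff ψ J.card * ∫ z, ∏ j ∈ J, g (x j - z) := by
  have hM := fun J => (integrable_and_tendsto_moment hψ hψs hg hg_pow hν hν_cont x J).2
  refine CumulantRecursion.truncation_eq (M := moment ν x)
    (T := fun J => levyCoeff ψ J.card * ∫ z, ∏ j ∈ J, g (x j - z)) (by simp [moment]) ?_ J hJ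
  intro k J hk
  refine tendsto_nhds_unique (hM (insert k J)) ?_
  have : Tendsto (fun n => ∑ A ∈ J.powerset, (levyCoeff ψ (insert k A).card *
      ∫ z, ∏ j ∈ insert k A, smear g (mollifier n (x j)) z) *
      ∫ φ : Tempered d, ∏ j ∈ J \ A, φ (mollifier n (x j)) ∂ν) atTop
      (𝓝 (∑ A ∈ J.powerset, (levyCoeff ψ (insert k A).card *
        ∫ z, ∏ j ∈ insert k A, g (x j - z)) * moment ν x (J \ A))) :=
    tendsto_finsetSum _ fun A _ => (tendsto_cumulant_mollifier hg hg_pow x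
      (Finset.insert_nonempty k A)).mul (hM (J \ A))
  refine this.congr fun n => ?_
  exact (cumulantRecursion_smeared_field hψ hψs hg hν (fun j => mollifier n (x j)) k J hk).symm

end Moments

end LevyFeynman

namespace LevyFeynman

open Filter Topology

/-! ### The Lévy representation -/

theorem iteratedDeriv_drift_add_gaussian (a σ : ℝ) {l : ℕ} (hl : 1 ≤ l) :
    iteratedDeriv l (fun t : ℝ => Complex.I * a * t - (σ : ℂ) ^ 2 / 2 * (t : ℂ) ^ 2) 0 =
      Complex.I ^ l * ((if l = 1 then a else 0) + (if l = 2 then σ ^ 2 else 0) : ℝ) := by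
  have hid : ∀ t : ℝ, HasDerivAt (fun t : ℝ => (t : ℂ)) 1 t := fun t =>
    (hasDerivAt_id t).ofReal_comp
  have h1 : deriv (fun t : ℝ => Complex.I * a * t - (σ : ℂ) ^ 2 / 2 * (t : ℂ) ^ 2) =
      fun t : ℝ => Complex.I * a - (σ : ℂ) ^ 2 * t := by
    funext t
    refine HasDerivAt.deriv ((((hid t).const_mul (Complex.I * a)).sub
      (((hid t).pow 2).const_mul ((σ : ℂ) ^ 2 / 2))).congr_deriv ?_)
    push_cast
    ring
  have h2 : deriv (fun t : ℝ => Complex.I * a - (σ : ℂ) ^ 2 * t) = fun _ => -(σ : ℂ) ^ 2 := by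
    funext t
    refine HasDerivAt.deriv ((((hid t).const_mul ((σ : ℂ) ^ 2)).const_sub
      (Complex.I * a)).congr_deriv ?_)
    ring
  have h3 : deriv (fun _ : ℝ => -(σ : ℂ) ^ 2) = fun _ => 0 := by
    funext t; exact deriv_const _ _
  match l, hl with
  | 1, _ => rw [iteratedDeriv_one, h1]; simp
  | 2, _ => rw [iteratedDeriv_succ', iteratedDeriv_one, h1, h2]; simp
  | l + 3, _ =>
    rw [iteratedDeriv_succ', iteratedDeriv_succ', iteratedDeriv_succ', h1, h2, h3,
      iteratedDeriv_const]
    simp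

/-- The jump part is `z (charFun r - 1)`, whose derivatives at zero of order `l ≥ 1` are `z i^l`
times the moments of `r`. -/
theorem HasLevyRepresentation.levyCoeff_eq {ψ : ℝ → ℂ} {a σ z : ℝ} {r : Measure ℝ}
    (h : HasLevyRepresentation ψ a σ z r) {l : ℕ} (hl : 1 ≤ l) :
    levyCoeff ψ l =
      (if l = 1 then a else 0) + (if l = 2 then σ ^ 2 else 0) + z * ∫ s, s ^ l ∂r := by
  have := h.isProbabilityMeasure
  have hmem : ∀ p : ℕ, MemLp id p r := memLp_of_integrable_pow_even
    aestronglyMeasurable_id fun n => by simpa using h.moments (2 * n)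
  have hψ : ψ = fun t : ℝ => (Complex.I * a * t - (σ : ℂ) ^ 2 / 2 * (t : ℂ) ^ 2) +
      (z : ℂ) * (charFun r t - 1) := by
    funext t
    rw [h.eq t, charFun_apply_real]
    congr 2
    have hexp : ∀ s : ℝ, Complex.exp (Complex.I * s * t) = Complex.exp (t * s * Complex.I) :=
      fun s => by congr 1; ring
    have hint : Integrable (fun s : ℝ => Complex.exp (t * s * Complex.I)) r := by
      refine Integrable.of_bound (C := 1) (by fun_prop) (Eventually.of_forall fun s => ?_)
      rw [← Complex.ofReal_mul, Complex.norm_exp_ofReal_mul_I]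
    simp only [hexp]
    rw [integral_sub hint (integrable_const _)]
    simp
  have hc : ContDiff ℝ l (charFun r) := contDiff_charFun (hmem l)
  have hof : ContDiff ℝ l (fun t : ℝ => (t : ℂ)) := Complex.ofRealCLM.contDiff
  have hp : ContDiff ℝ l (fun t : ℝ => Complex.I * a * t - (σ : ℂ) ^ 2 / 2 * (t : ℂ) ^ 2) :=
    (contDiff_const.mul hof).sub (contDiff_const.mul (hof.pow 2))
  have hsub : iteratedDeriv l (fun t => charFun r t - 1) 0 = iteratedDeriv l (charFun r) 0 := by
    rw [iteratedDeriv_fun_sub hc.contDiffAt contDiffAt_const, iteratedDeriv_const,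
      if_neg (by omega), sub_zero]
  rw [levyCoeff, hψ, iteratedDeriv_fun_add hp.contDiffAt
    (contDiff_const.mul (hc.sub contDiff_const)).contDiffAt, iteratedDeriv_const_mul_field, hsub,
    iteratedDeriv_charFun_zero (hmem l), iteratedDeriv_drift_add_gaussian a σ hl]
  have h1 : (-Complex.I) ^ l * Complex.I ^ l = 1 := by rw [← mul_pow]; simp
  have h2 : ∀ p m : ℝ, (-Complex.I) ^ l * (Complex.I ^ l * (p : ℂ) +
      z * (Complex.I ^ l * (m : ℂ))) = ((p + z * m : ℝ) : ℂ) := by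
    intro p m
    push_cast
    linear_combination (p + z * m : ℂ) * h1
  rw [h2, Complex.ofReal_re]

/-! ### Feynman rules -/

namespace Graph

variable {n m d : ℕ} (G : Graph n m) {g : Space d → ℝ} {c : ℕ → ℝ}

theorem edgesAt_nonempty (q : Fin G.numEmpty) : (G.edgesAt q).Nonempty := by
  obtain ⟨e, he⟩ := G.surjective q
  exact ⟨e, by simp [edgesAt, he]⟩

theorem prod_edges_eq (g : Space d → ℝ) (w : Leg n m G.type → Space d)
    (z : Fin G.numEmpty → Space d) :
    ∏ e, g (w e - z (G.emptyEnd e)) = ∏ q, ∏ e ∈ G.edgesAt q, g (w e - z q) := by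
  rw [← Finset.prod_fiberwise Finset.univ G.emptyEnd]
  refine Finset.prod_congr rfl fun q _ => Finset.prod_congr rfl fun e he => ?_
  rw [(Finset.mem_filter.1 he).2]

theorem integral_levyIntegrand (v : Polynomial ℝ) (x : Fin n → Space d) (y : Fin m → Space d) :
    ∫ z, G.levyIntegrand g c v x y z =
      (∏ q, (c (G.edgesAt q).card * ∫ z, ∏ e ∈ G.edgesAt q, g (G.fullEnd x y e - z))) *
        ∏ j, v.coeff (G.type j) := by
  simp only [levyIntegrand, prod_edges_eq]
  rw [integral_mul_const, integral_mul_const, Finset.prod_mul_distrib,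
    ← integral_fintype_prod_volume_eq_prod (E := fun _ => Space d)
      (fun q z => ∏ e ∈ G.edgesAt q, g (G.fullEnd x y e - z))]
  ring

theorem measurable_fullEnd (x : Fin n → Space d) (e : Leg n m G.type) :
    Measurable fun y : Fin m → Space d => G.fullEnd x y e := by
  rcases e with i | ⟨j, i⟩
  · exact measurable_const
  · exact measurable_pi_apply j

/-- `g` is only almost everywhere strongly measurable, so null sets must pull back to null sets. For
fixed `y` the map is a reflection and translation of the single coordinate `z_q`. -/
theorem quasiMeasurePreserving_fullEnd_sub (x : Fin n → Space d) (e : Leg n m G.type)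
    (q : Fin G.numEmpty) (μ : Measure (Fin m → Space d)) [SFinite μ] :
    Measure.QuasiMeasurePreserving
      (fun w : (Fin m → Space d) × (Fin G.numEmpty → Space d) => G.fullEnd x w.1 e - w.2 q)
      (μ.prod volume) volume := by
  refine QuasiMeasurePreserving.prod_of_right ?_ (Eventually.of_forall fun y => ?_)
  · exact ((G.measurable_fullEnd x e).comp measurable_fst).sub
      ((measurable_pi_apply q).comp measurable_snd)
  · exact (volume.measurePreserving_sub_left (G.fullEnd x y e)).quasiMeasurePreserving.comp
      (Measure.quasiMeasurePreserving_eval (fun _ => volume) q)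

/-- For fixed `y` the integral of the absolute value over `z` factors over the empty vertices.
Hölder and translation invariance bound each factor by `‖g‖_l^l`, independently of `y`, and the
measure in `y` is finite. -/
theorem integrable_levyIntegrand
    (hg_pow : ∀ l : ℕ, 1 ≤ l → c l ≠ 0 → MemLp g (l : ℝ≥0∞)) (hg : AEStronglyMeasurable g)
    (v : Polynomial ℝ) (x : Fin n → Space d) (μ : Measure (Fin m → Space d)) [IsFiniteMeasure μ] :
    Integrable (fun w : (Fin m → Space d) × (Fin G.numEmpty → Space d) =>
      G.levyIntegrand g c v x w.1 w.2) (μ.prod volume) := by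
  by_cases hc : ∏ q, c (G.edgesAt q).card = 0
  · simp [levyIntegrand, hc]
  have hgq : ∀ q, MemLp g ((G.edgesAt q).card : ℝ≥0∞) := fun q =>
    hg_pow _ (G.edgesAt_nonempty q).card_pos (Finset.prod_ne_zero_iff.1 hc q (Finset.mem_univ q))
  have hq : ∀ y q, Integrable fun z => ∏ e ∈ G.edgesAt q, g (G.fullEnd x y e - z) := fun y q =>
    integrable_prod_of_memLp (G.edgesAt_nonempty q) fun e _ => memLp_comp_sub_left (hgq q) _
  have hbound : ∀ y q, ∫ z, ‖∏ e ∈ G.edgesAt q, g (G.fullEnd x y e - z)‖ ≤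
      (eLpNorm g ((G.edgesAt q).card : ℝ≥0∞) volume ^ (G.edgesAt q).card).toReal := by
    intro y q
    rw [integral_norm_eq_lintegral_enorm (hq y q).aestronglyMeasurable]
    refine ENNReal.toReal_mono (ENNReal.pow_ne_top (hgq q).2.ne) ?_
    refine (lintegral_enorm_prod_le (G.edgesAt_nonempty q)
      fun e _ => (memLp_comp_sub_left (hgq q) (G.fullEnd x y e)).1).trans (le_of_eq ?_)
    rw [← Finset.prod_const]
    refine Finset.prod_congr rfl fun e _ => ?_
    exact eLpNorm_comp_measurePreserving hg (volume.measurePreserving_sub_left (G.fullEnd x y e))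
  have hmeas : AEStronglyMeasurable
      (fun w : (Fin m → Space d) × (Fin G.numEmpty → Space d) =>
        ∏ e, g (G.fullEnd x w.1 e - w.2 (G.emptyEnd e))) (μ.prod volume) :=
    Finset.aestronglyMeasurable_fun_prod _ fun e _ =>
      hg.comp_quasiMeasurePreserving (G.quasiMeasurePreserving_fullEnd_sub x e _ μ)
  refine Integrable.mul_const (Integrable.mul_const ?_ _) _
  rw [integrable_prod_iff hmeas]
  refine ⟨Eventually.of_forall fun y => ?_, ?_⟩
  · simp only [prod_edges_eq]
    exact Integrable.fintype_prod (f := fun q z => ∏ e ∈ G.edgesAt q, g (G.fullEnd x y e - z))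
      (hq y)
  · refine Integrable.of_bound hmeas.norm.integral_prod_right'
      (C := ∏ q, (eLpNorm g ((G.edgesAt q).card : ℝ≥0∞) volume ^ (G.edgesAt q).card).toReal)
      (Eventually.of_forall fun y => ?_)
    rw [Real.norm_of_nonneg (integral_nonneg fun _ => norm_nonneg _)]
    simp only [prod_edges_eq, norm_prod (Finset.univ : Finset (Fin G.numEmpty))]
    rw [integral_fintype_prod_volume_eq_prod (E := fun _ => Space d)
      (fun q z => ‖∏ e ∈ G.edgesAt q, g (G.fullEnd x y e - z)‖)]
    exact Finset.prod_le_prod (fun q _ => integral_nonneg fun _ => norm_nonneg _)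
      fun q _ => hbound y q

end Graph

end LevyFeynman

/-! ### The main theorem. -/

theorem theorem4p1 {d : ℕ} (hd : 0 < d)
    (ψ : ℝ → ℂ) (hψ : LevyFeynman.IsLevyCharacteristic ψ) (hψ_smooth : ContDiffAt ℝ ∞ ψ 0)
    (g : LevyFeynman.Space d → ℝ) (hg : Integrable g)
    (hg_pow : ∀ l : ℕ, 1 ≤ l → LevyFeynman.levyCoeff ψ l ≠ 0 → MemLp g (l : ℝ≥0∞))
    (ν : Measure (LevyFeynman.Tempered d)) [IsProbabilityMeasure ν]
    (hν : LevyFeynman.IsConvolutedLevyNoise ν ψ g)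
    (hν_cont : LevyFeynman.SupportedOnContinuous ν) :
    -- the constants are given by the derivatives of `ψ` at zero
    (∀ l : ℕ, (LevyFeynman.levyCoeff ψ l : ℂ) = (-Complex.I) ^ l * iteratedDeriv l ψ 0) ∧
    (∀ (a σ z : ℝ) (r : Measure ℝ), LevyFeynman.HasLevyRepresentation ψ a σ z r →
      ∀ l : ℕ, 1 ≤ l → LevyFeynman.levyCoeff ψ l =
        (if l = 1 then a else 0) + (if l = 2 then σ ^ 2 else 0) + z * ∫ s, s ^ l ∂r) ∧
    -- the moments exist, and the truncated moment functions
    (∀ (l : ℕ) (x : Fin l → LevyFeynman.Space d),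
      Integrable (fun φ => ∏ j, LevyFeynman.fieldAt φ (x j)) ν) ∧
    (∀ (l : ℕ), 1 ≤ l → ∀ x : Fin l → LevyFeynman.Space d,
      Integrable (fun z => LevyFeynman.levyCoeff ψ l * ∏ j, g (x j - z)) ∧
      LevyFeynman.truncatedMoment ν x Finset.univ =
        LevyFeynman.levyCoeff ψ l * ∫ z, ∏ j, g (x j - z)) ∧
    -- the Feynman rules
    (∀ (v : Polynomial ℝ) (Λ : Set (LevyFeynman.Space d)),
      Bornology.IsBounded Λ → MeasurableSet Λ →
      ∀ (n m : ℕ), ∀ G ∈ LevyFeynman.feynmanGraphs v n m, ∀ x : Fin n → LevyFeynman.Space d,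
        IntegrableOn (fun y => G.integrand ν v x y) (Set.univ.pi fun _ => Λ) ∧
        IntegrableOn
          (fun w : (Fin m → LevyFeynman.Space d) × (Fin G.numEmpty → LevyFeynman.Space d) =>
            G.levyIntegrand g (LevyFeynman.levyCoeff ψ) v x w.1 w.2) (G.innerDomain Λ) ∧
        G.value ν v Λ x =
          ∫ w in G.innerDomain Λ,
            G.levyIntegrand g (LevyFeynman.levyCoeff ψ) v x w.1 w.2) := by
  have hM := fun {l : ℕ} (x : Fin l → LevyFeynman.Space d) =>
    (LevyFeynman.integrable_and_tendsto_moment hψ hψ_smooth hg hg_pow hν hν_cont x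
      Finset.univ).1
  refine ⟨LevyFeynman.ofReal_levyCoeff hψ.hermitian,
    fun a σ z r h l hl => h.levyCoeff_eq hl, fun l x => hM x, fun l hl x => ⟨?_, ?_⟩, ?_⟩
  · by_cases hc : LevyFeynman.levyCoeff ψ l = 0
    · simp [hc]
    · have : Nonempty (Fin l) := ⟨⟨0, hl⟩⟩
      refine Integrable.const_mul (LevyFeynman.integrable_prod_of_memLp Finset.univ_nonempty
        fun j _ => LevyFeynman.memLp_comp_sub_left ?_ (x j)) _
      rw [Finset.card_univ, Fintype.card_fin]
      exact hg_pow l hl hc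
  · have : Nonempty (Fin l) := ⟨⟨0, hl⟩⟩
    have := LevyFeynman.truncatedMoment_eq hψ hψ_smooth hg hg_pow hν hν_cont x
      (Finset.univ_nonempty (α := Fin l))
    rwa [Finset.card_univ, Fintype.card_fin] at this
  · intro v Λ hΛ hΛm n m G _ x
    have hfin : volume (Set.univ.pi fun _ : Fin m => Λ) < ⊤ := by
      rw [volume_pi_pi]
      exact ENNReal.prod_lt_top fun _ _ => hΛ.measure_lt_top
    have : IsFiniteMeasure (volume.restrict (Set.univ.pi fun _ : Fin m => Λ)) :=
      isFiniteMeasure_restrict.2 hfin.ne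
    have hres : (volume : Measure ((Fin m → LevyFeynman.Space d) ×
        (Fin G.numEmpty → LevyFeynman.Space d))).restrict (G.innerDomain Λ) =
        (volume.restrict (Set.univ.pi fun _ : Fin m => Λ)).prod volume := by
      rw [LevyFeynman.Graph.innerDomain, Measure.volume_eq_prod, ← Measure.prod_restrict,
        Measure.restrict_univ]
    have hint := G.integrable_levyIntegrand hg_pow hg.aestronglyMeasurable v x
      (volume.restrict (Set.univ.pi fun _ : Fin m => Λ))
    -- The truncated moments are indexed by legs, so several legs at one full vertex are just
    -- coinciding points. Integrating this pointwise identity over `y` leaves only Fubini.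
    have hval : ∀ y, G.integrand ν v x y =
        ∫ z, G.levyIntegrand g (LevyFeynman.levyCoeff ψ) v x y z := by
      intro y
      rw [G.integral_levyIntegrand, LevyFeynman.Graph.integrand]
      congr 1
      exact Finset.prod_congr rfl fun q _ => LevyFeynman.truncatedMoment_eq hψ hψ_smooth hg
        hg_pow hν hν_cont _ (G.edgesAt_nonempty q)
    refine ⟨?_, ?_, ?_⟩
    · rw [IntegrableOn, funext hval]
      exact hint.integral_prod_left
    · rw [IntegrableOn, hres]
      exact hint
    · rw [LevyFeynman.Graph.value, funext hval, hres, integral_prod _ hint]
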